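/- Let $d\ge 1$ be an integer with $d\not\equiv 1 \pmod 4$, and let $\mathbb T^d=\mathbb R^d/\mathbb Z^d$ with its Lebesgue measure $|\cdot|$, normalized so that $|\mathbb T^d|=1$. For $\rho>0$ let $B_\rho=\{x\in\mathbb R^d:|x|<\rho\}+\mathbb Z^d\subseteq\mathbb T^d$ be the open Euclidean ball of radius $\rho$ centered at $0$ in the torus. For a finite sequence $\mathcal P_N=\{p_n\}_{n=1}^N$ in $\mathbb T^d$ and a measurable set $A\subseteq\mathbb T^d$ put $$\mathscr D(A,\mathcal P_N)=\sum_{n=1}^N\chi_A(p_n)-N|A| .$$ For a positive integer $M$ let $\mathbb J_M=\{j\in\mathbb Z: -M/2\le j<M/2\}$. There exist constants $C,c>0$, depending only on $d$, such that for every $0<r<1/4$, every positive integer $N$, every even positive integer $M$ with $M\ge C\,N^{1+\frac1{2d}}\,r^{-1}$, and every finite sequence $\mathcal P_N=\{p_n\}_{n=1}^N$ in $\mathbb T^d$, $$\Bigg(\frac1{(\operatorname{card}\mathbb J_M)^d}\sum_{k=1,2}\ \sum_{j_1,\dots,j_d\in\mathbb J_M}\Big|\mathscr D\Big(\Big(\frac{j_1}M,\dots,\frac{j_d}M\Big)+B_{kr},\mathcal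 P_N\Big)\Big|^2\Bigg)^{1/2}\ \ge\ c\,r^{\frac d2}\,N^{\frac12-\frac1{2d}} .$$ -/

import Mathlib

noncomputable section

/-- The projection `ℝ^d → 𝕋^d = ℝ^d / ℤ^d`. -/
def toTorus {d : ℕ} (x : EuclideanSpace ℝ (Fin d)) : UnitAddTorus (Fin d) :=
  fun i => (x i : UnitAddCircle)

/-- The ball of radius `r` and center `0` in the torus: the projection to `𝕋^d` of the open
Euclidean ball of radius `r` of `ℝ^d`, that is, the `ℤ^d`-periodization of that ball. -/
def torusBall (d : ℕ) (r : ℝ) : Set (UnitAddTorus (Fin d)) :=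
  toTorus '' Metric.ball (0 : EuclideanSpace ℝ (Fin d)) r

/-- The translate `x + A` of a subset `A` of the torus. -/
def torusTranslate {d : ℕ} (x : UnitAddTorus (Fin d)) (A : Set (UnitAddTorus (Fin d))) :
    Set (UnitAddTorus (Fin d)) :=
  (fun y => x + y) '' A

/-- The discrepancy `∑ₙ χ_A(pₙ) - N |A|` of the finite sequence `p` with respect to `A`, where
`|A|` is the normalized Lebesgue measure on the torus. -/
def discrepancy {d N : ℕ} (A : Set (UnitAddTorus (Fin d)))
    (p : Fin N → UnitAddTorus (Fin d)) : ℝ :=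
  (∑ n, A.indicator (fun _ => (1 : ℝ)) (p n)) - (N : ℝ) * (MeasureTheory.volume A).toReal

/-- The set `𝕁_M` of the integers `j` with `-M/2 ≤ j < M/2`. -/
def gridIndices (M : ℕ) : Finset ℤ :=
  Finset.Ico ⌈-(M : ℝ) / 2⌉ ⌈(M : ℝ) / 2⌉

theorem mem_gridIndices {M : ℕ} {j : ℤ} :
    j ∈ gridIndices M ↔ -(M : ℝ) / 2 ≤ (j : ℝ) ∧ (j : ℝ) < (M : ℝ) / 2 := by
  simp [gridIndices, Int.ceil_le, Int.lt_ceil]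

/-- The grid point `(j₁/M, …, j_d/M)` of the torus. -/
def gridPoint {d : ℕ} (M : ℕ) (j : Fin d → ℤ) : UnitAddTorus (Fin d) :=
  toTorus (WithLp.toLp 2 fun i => (j i : ℝ) / (M : ℝ))

end

/-!
The mean over the grid is an integral over the torus: since `M` is even, the cells of side `1/M` at
the grid points tile the cube `(-1/2, 1/2]^d`, so the mean of `|𝒟|²` is the squared `L²` norm of the
function `stepDiscrepancy` that is constant on the cells (`integral_gridRound`). By Bessel's
inequality it dominates the squares of any finite set of Fourier coefficients. At a frequency
`m ≠ 0` the term `N |A|` drops out, and the coefficient is `ballCoeff · expSum`, the Fourier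
coefficient of the ball times `∑ₙ e(-m · pₙ)`, up to a rounding error
(`norm_integral_stepDiscrepancy_sub_le`): rounding changes the membership of a point in the ball
only on a spherical shell of thickness `O(1/M)`, so the error is `O(N r^(d-1) / M)`. Bounding each
coefficient separately in this way, rather than the error in `L²`, is what allows the exponent
`1 + 1/(2d)` of `N` in the hypothesis on `M`.

*Fourier coefficients of balls.* Slicing turns the Fourier transform of the unit ball into
`oscIntegral α t = ∫_{-1}^1 (1 - s²)^α e^{its} ds` with `α = (d - 1)/2`
(`integral_ball_exp_inner`). Moving the contour to the vertical half lines above `±1` shows that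
`t^(α+1) oscIntegral α t` is a positive multiple of `sin (t - πα/2)` up to `o(1)`. This sine and
its value at `2t` are simultaneously small only when `sin (πα/2)` vanishes, that is, when
`d ≡ 1 mod 4`. Hence for `|m| ≥ C/r` one of the two radii `r`, `2r` has a coefficient of squared
size at least `c r^(d-1) |m|^(-d-1)` (`exists_le_ballCoeff_sq`).

*Exponential sums.* By the Cassels–Montgomery argument the sum of `|expSum|²` over the box
`|m_i| < X` is at least `N X^d` (`le_sum_sq_norm_expSum`). The `O(r^(-d))` frequencies with
`|m| < C/r`, where the ball coefficients are not controlled, contribute at most `O(r^(-d) N²)`. With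
`X` a large multiple of `N^(1/d) / r` this is less than half of the total, the remaining frequencies
give the lower bound `c N X^d · r^(d-1) X^(-d-1)`, which is of order `r^d N^(1-1/d)`, and the
`O(X^d)` rounding errors together are smaller by the factor `C²`.
-/

open MeasureTheory Set Filter Topology Complex

noncomputable section

open UnitAddTorus (mFourier mFourier_neg mFourier_add mFourier_zero)

/-! ### The Fourier transform of `(1 - s²)^α` -/

/-- The integrand `(1 - z²)^α e^{itz}`, continued to the half strip above `[-1, 1]`. -/
def oscIntegrand (α t : ℝ) (z : ℂ) : ℂ := (1 - z ^ 2) ^ (α : ℂ) * cexp (I * t * z)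

/-- The Fourier transform `∫_{-1}^1 (1 - s²)^α e^{its} ds`; up to a power of `t` and a constant it
is the Bessel function `J_{α + 1/2}(t)`. -/
def oscIntegral (α t : ℝ) : ℂ := ∫ s in (-1 : ℝ)..1, oscIntegrand α t s

lemma one_sub_sq_re_nonneg {z : ℂ} (hz : |z.re| ≤ 1) : 0 ≤ (1 - z ^ 2).re := by
  have : z.re ^ 2 ≤ 1 := by rw [sq_le_one_iff_abs_le_one]; exact hz
  simp [pow_two]; nlinarith [sq_nonneg z.im]

lemma one_sub_sq_re_pos {z : ℂ} (hz : |z.re| < 1) : 0 < (1 - z ^ 2).re := by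
  have : z.re ^ 2 < 1 := by rw [sq_lt_one_iff_abs_lt_one]; exact hz
  simp [pow_two]; nlinarith [sq_nonneg z.im]

/-- For `α > 0` the principal power `z^α` is continuous on the closed right half plane, the branch
point `0` included. -/
lemma continuousAt_cpow_const_of_re_nonneg {α : ℝ} (hα : 0 < α) {z : ℂ} (hz : 0 ≤ z.re) :
    ContinuousAt (fun w : ℂ => w ^ (α : ℂ)) z :=
  Complex.continuousAt_cpow_const_of_re_pos (Or.inl hz) (by simpa using hα)

lemma continuousAt_oscIntegrand {α : ℝ} (hα : 0 < α) (t : ℝ) {z : ℂ} (hz : |z.re| ≤ 1) :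
    ContinuousAt (oscIntegrand α t) z := by
  unfold oscIntegrand
  have h1 : ContinuousAt (fun z : ℂ => (1 - z ^ 2) ^ (α : ℂ)) z :=
    ContinuousAt.comp (f := fun z : ℂ => 1 - z ^ 2)
      (continuousAt_cpow_const_of_re_nonneg hα (one_sub_sq_re_nonneg hz)) (by fun_prop)
  exact h1.mul (by fun_prop)

lemma differentiableAt_oscIntegrand (α t : ℝ) {z : ℂ} (hz : |z.re| < 1) :
    DifferentiableAt ℂ (oscIntegrand α t) z := by
  unfold oscIntegrand
  have h1 : DifferentiableAt ℂ (fun z : ℂ => (1 - z ^ 2) ^ (α : ℂ)) z :=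
    DifferentiableAt.cpow (by fun_prop) (by fun_prop) (Or.inl (one_sub_sq_re_pos hz))
  exact h1.mul (by fun_prop)

lemma norm_oscIntegrand (α t : ℝ) (z : ℂ) :
    ‖oscIntegrand α t z‖ = ‖1 - z ^ 2‖ ^ α * Real.exp (-t * z.im) := by
  rw [oscIntegrand, norm_mul, Complex.norm_cpow_real, Complex.norm_exp]
  simp

/-- The integrand along the vertical half line from `1`. -/
lemma oscIntegrand_one_add (α t y : ℝ) :
    oscIntegrand α t (1 + y * I) =
      cexp (I * t) * (((y : ℂ) ^ 2 - 2 * I * y) ^ (α : ℂ) * Real.exp (-t * y)) := by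
  have h1 : (1 : ℂ) - (1 + y * I) ^ 2 = (y : ℂ) ^ 2 - 2 * I * y := by
    ring_nf; simp
  have h2 : I * t * (1 + y * I) = I * t + ((-t * y : ℝ) : ℂ) := by
    push_cast; ring_nf; simp; ring
  rw [oscIntegrand, h1, h2, Complex.exp_add, Complex.ofReal_exp]
  ring

lemma oscIntegrand_neg_conj {α t : ℝ} {z : ℂ} (hz : (1 - z ^ 2).arg ≠ Real.pi) :
    oscIntegrand α t (-(starRingEnd ℂ) z) = (starRingEnd ℂ) (oscIntegrand α t z) := by
  have h1 : (1 : ℂ) - (-(starRingEnd ℂ) z) ^ 2 = (starRingEnd ℂ) (1 - z ^ 2) := by simp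
  have h2 : I * t * (-(starRingEnd ℂ) z) = (starRingEnd ℂ) (I * t * z) := by simp
  rw [oscIntegrand, oscIntegrand, h1, h2, map_mul (starRingEnd ℂ) (_ ^ _), ← Complex.exp_conj,
    Complex.conj_cpow _ _ hz, Complex.conj_ofReal]

/-- The two vertical half lines contribute complex conjugate values. -/
lemma oscIntegrand_neg_one_add (α t y : ℝ) :
    oscIntegrand α t (-1 + y * I) = (starRingEnd ℂ) (oscIntegrand α t (1 + y * I)) := by
  rw [← oscIntegrand_neg_conj]
  · congr 1
    simp
    ring
  · have : (1 : ℂ) - (1 + y * I) ^ 2 = (y : ℂ) ^ 2 - 2 * I * y := by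
      ring_nf; simp
    rw [this]
    intro h
    rw [Complex.arg_eq_pi_iff] at h
    have := h.1
    simp [pow_two] at this
    nlinarith

/-- The contribution `∫₀^∞ (y² - 2iy)^α e^{-ty} dy` of the endpoint `1`. -/
def endpointIntegral (α t : ℝ) : ℂ :=
  ∫ y in Ioi (0 : ℝ), ((y : ℂ) ^ 2 - 2 * I * y) ^ (α : ℂ) * Real.exp (-t * y)

lemma norm_mul_sq_sub_le {y : ℝ} (hy : 0 ≤ y) {u : ℝ} (hu : 0 ≤ u) (hu1 : u ≤ 1) :
    ‖(u * y ^ 2 - 2 * I * y : ℂ)‖ ≤ 2 * (y * (y + 1)) := by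
  calc ‖(u * y ^ 2 - 2 * I * y : ℂ)‖ ≤ ‖(u * y ^ 2 : ℂ)‖ + ‖(2 * I * y : ℂ)‖ := norm_sub_le _ _
    _ = u * y ^ 2 + 2 * y := by
        simp [abs_of_nonneg hy, abs_of_nonneg hu]
    _ ≤ 2 * (y * (y + 1)) := by nlinarith [mul_nonneg hy hy, 
        mul_le_mul_of_nonneg_right hu1 (mul_nonneg hy hy)]

/-- Integrable majorant for the rescaled endpoint integrand. -/
lemma integrableOn_endpoint_majorant {α : ℝ} (hα : 0 < α) :
    IntegrableOn (fun w : ℝ => (2 * (w * (w + 1))) ^ α * Real.exp (-w)) (Ioi 0) := by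
  have h1 := (Real.GammaIntegral_convergent (s := 2 * α + 1) (by linarith)).const_mul ((4:ℝ) ^ α)
  have h2 := (Real.GammaIntegral_convergent (s := α + 1) (by linarith)).const_mul ((4:ℝ) ^ α)
  refine (h1.add h2).mono' ?_ ?_
  · refine (ContinuousOn.mul ?_ (by fun_prop)).aestronglyMeasurable measurableSet_Ioi
    exact ContinuousOn.rpow_const (by fun_prop) (fun _ _ => Or.inr hα.le)
  · refine (ae_restrict_iff' measurableSet_Ioi).2 (Eventually.of_forall fun w hw => ?_)
    have hw : 0 < w := hw
    have e1 : (4:ℝ) ^ α * (w ^ (2 * α)) = (4 * w ^ 2) ^ α := by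
      rw [Real.mul_rpow (by norm_num) (by positivity), Real.rpow_mul hw.le]; norm_num
    have e2 : (4:ℝ) ^ α * (w ^ α) = (4 * w) ^ α := by
      rw [Real.mul_rpow (by norm_num) (by positivity)]
    have key : (2 * (w * (w + 1))) ^ α ≤ (4 * w ^ 2) ^ α + (4 * w) ^ α := by
      rcases le_total w 1 with h | h
      · have : (2 * (w * (w + 1))) ^ α ≤ (4 * w) ^ α :=
          Real.rpow_le_rpow (by positivity) (by nlinarith) hα.le
        have : 0 ≤ (4 * w ^ 2) ^ α := by positivity
        linarith
      · have : (2 * (w * (w + 1))) ^ α ≤ (4 * w ^ 2) ^ α :=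
          Real.rpow_le_rpow (by positivity) (by nlinarith) hα.le
        have : 0 ≤ (4 * w) ^ α := by positivity
        linarith
    have hp : 0 < w * (w + 1) := by positivity
    rw [Real.norm_of_nonneg (by positivity)]
    simp only [Pi.add_apply, add_sub_cancel_right]
    rw [← e1, ← e2] at key
    nlinarith [Real.exp_pos (-w), mul_le_mul_of_nonneg_right key (Real.exp_pos (-w)).le]

lemma sq_sub_re_nonneg {u y : ℝ} (hu : 0 ≤ u) : 0 ≤ (u * y ^ 2 - 2 * I * y : ℂ).re := by
  have h : (u * y ^ 2 - 2 * I * y : ℂ).re = u * y ^ 2 := by simp [pow_two]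
  rw [h]; positivity

lemma continuous_endpoint {α : ℝ} (hα : 0 < α) {u : ℝ} (hu : 0 ≤ u) :
    Continuous fun y : ℝ => (u * (y : ℂ) ^ 2 - 2 * I * y) ^ (α : ℂ) := by
  rw [continuous_iff_continuousAt]
  intro y
  exact ContinuousAt.comp (f := fun y : ℝ => (u * (y : ℂ) ^ 2 - 2 * I * y))
      (continuousAt_cpow_const_of_re_nonneg hα (sq_sub_re_nonneg hu)) (by fun_prop)

lemma rpow_mul_cpow {α x : ℝ} (hx : 0 < x) (z : ℂ) :
    ((x ^ α : ℝ) : ℂ) * z ^ (α : ℂ) = ((x : ℂ) * z) ^ (α : ℂ) := by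
  by_cases hz : z = 0
  · subst hz
    by_cases h : α = 0
    · simp [h]
    · simp [h]
  have hx' : (x : ℂ) ≠ 0 := by exact_mod_cast hx.ne'
  rw [Complex.ofReal_cpow hx.le, Complex.cpow_def_of_ne_zero hx', Complex.cpow_def_of_ne_zero hz,
    Complex.cpow_def_of_ne_zero (mul_ne_zero hx' hz), Complex.log_ofReal_mul hx hz,
    ← Complex.exp_add, Complex.ofReal_log hx.le]
  ring_nf

/-- The substitution `y = w / t`. -/
lemma rpow_mul_endpointIntegral {α t : ℝ} (ht : 0 < t) :
    ((t ^ (α + 1) : ℝ) : ℂ) * endpointIntegral α t =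
      ∫ w in Ioi (0 : ℝ),
        (((t⁻¹ : ℝ) : ℂ) * (w : ℂ) ^ 2 - 2 * I * w) ^ (α : ℂ) * Real.exp (-w) := by
  have h := integral_comp_mul_left_Ioi
    (fun w : ℝ => (((t⁻¹ : ℝ) : ℂ) * (w : ℂ) ^ 2 - 2 * I * w) ^ (α : ℂ) * Real.exp (-w)) 0 ht
  rw [mul_zero] at h
  rw [Real.rpow_add ht, Real.rpow_one, mul_comm (t ^ α), Complex.ofReal_mul, mul_assoc,
    endpointIntegral, ← integral_const_mul ((t ^ α : ℝ) : ℂ)]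
  have h3 : ∀ y : ℝ, ((t ^ α : ℝ) : ℂ) * (((y : ℂ) ^ 2 - 2 * I * y) ^ (α : ℂ) * Real.exp (-t * y))
      = (((t⁻¹ : ℝ) : ℂ) * ((t * y : ℝ) : ℂ) ^ 2 - 2 * I * (t * y : ℝ)) ^ (α : ℂ)
        * Real.exp (-(t * y)) := by
    intro y
    rw [← mul_assoc, rpow_mul_cpow ht, neg_mul]
    congr 3
    have : (t : ℂ) ≠ 0 := by exact_mod_cast ht.ne'
    push_cast
    field_simp
  simp_rw [h3, h]
  rw [Complex.real_smul, ← mul_assoc]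
  have : (t : ℂ) ≠ 0 := by exact_mod_cast ht.ne'
  push_cast
  rw [mul_inv_cancel₀ this, one_mul]

/-- The limit of the rescaled endpoint integral. -/
def endpointLimit (α : ℝ) : ℂ :=
  ∫ w in Ioi (0 : ℝ), (-(2 * I * w)) ^ (α : ℂ) * Real.exp (-w)

/-- Dominated convergence in the rescaled endpoint integral, as `y² - 2iy ∼ -2iy` near `0`. -/
lemma tendsto_endpointIntegral {α : ℝ} (hα : 0 < α) :
    Tendsto (fun t : ℝ => ((t ^ (α + 1) : ℝ) : ℂ) * endpointIntegral α t) atTop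
      (𝓝 (endpointLimit α)) := by
  have : Tendsto (fun t : ℝ => ∫ w in Ioi (0 : ℝ),
      (((t⁻¹ : ℝ) : ℂ) * (w : ℂ) ^ 2 - 2 * I * w) ^ (α : ℂ) * Real.exp (-w)) atTop
      (𝓝 (endpointLimit α)) := by
    refine tendsto_integral_filter_of_dominated_convergence
      (fun w : ℝ => (2 * (w * (w + 1))) ^ α * Real.exp (-w)) ?_ ?_
      (integrableOn_endpoint_majorant hα) ?_
    · filter_upwards [eventually_gt_atTop 0] with t ht
      refine (Continuous.mul (continuous_endpoint hα (inv_pos.2 ht).le) ?_).aestronglyMeasurable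
      fun_prop
    · filter_upwards [eventually_ge_atTop 1] with t ht
      refine (ae_restrict_iff' measurableSet_Ioi).2 (Eventually.of_forall fun w hw => ?_)
      have hw : 0 < w := hw
      rw [norm_mul, Complex.norm_cpow_real, Complex.norm_real,
        Real.norm_of_nonneg (Real.exp_pos _).le]
      gcongr
      exact norm_mul_sq_sub_le hw.le (by positivity) (inv_le_one_of_one_le₀ ht)
    · refine Eventually.of_forall fun w => ?_
      refine Tendsto.mul_const _ ?_
      have h0 : Tendsto (fun t : ℝ => (((t⁻¹ : ℝ) : ℂ) * (w : ℂ) ^ 2 - 2 * I * w)) atTop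
          (𝓝 (-(2 * I * w))) := by
        have h1 : Tendsto (fun t : ℝ => ((t⁻¹ : ℝ) : ℂ)) atTop (𝓝 ((0 : ℝ) : ℂ)) :=
          (Complex.continuous_ofReal.tendsto 0).comp tendsto_inv_atTop_zero
        simpa using (h1.mul_const ((w : ℂ) ^ 2)).sub_const (2 * I * w)
      exact ContinuousAt.tendsto (f := fun w : ℂ => w ^ (α : ℂ))
        (continuousAt_cpow_const_of_re_nonneg hα (by simp)) |>.comp h0
  refine this.congr' ?_
  filter_upwards [eventually_gt_atTop 0] with t ht
  exact (rpow_mul_endpointIntegral ht).symm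

lemma endpointLimit_eq {α : ℝ} (hα : 0 < α) :
    endpointLimit α =
      ((2 ^ α * Real.Gamma (α + 1) : ℝ) : ℂ) * cexp (-((Real.pi * α / 2 : ℝ) : ℂ) * I) := by
  have h1 : ∀ w ∈ Ioi (0:ℝ), (-(2 * I * w)) ^ (α : ℂ) * Real.exp (-w) =
      ((2 ^ α : ℝ) : ℂ) * cexp (-((Real.pi * α / 2 : ℝ) : ℂ) * I) *
        ((Real.exp (-w) * w ^ (α + 1 - 1) : ℝ) : ℂ) := by
    intro w hw
    have hw : 0 < w := hw
    have e : (-(2 * I * w) : ℂ) = ((2 * w : ℝ) : ℂ) * (-I) := by push_cast; ring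
    rw [e, ← rpow_mul_cpow (by positivity), Real.mul_rpow (by norm_num) hw.le,
      Complex.cpow_def_of_ne_zero (by simp), Complex.log_neg_I, add_sub_cancel_right]
    have : -(Real.pi / 2 : ℂ) * I * α = -((Real.pi * α / 2 : ℝ) : ℂ) * I := by push_cast; ring
    rw [this]
    push_cast
    ring
  rw [endpointLimit, setIntegral_congr_fun measurableSet_Ioi h1, integral_const_mul,
    integral_complex_ofReal, ← Real.Gamma_eq_integral (by linarith)]
  push_cast
  ring

lemma integrableOn_oscIntegrand_one_add {α t : ℝ} (hα : 0 < α) (ht : 0 < t) :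
    IntegrableOn (fun y : ℝ => oscIntegrand α t (1 + y * I)) (Ioi 0) := by
  have h0 : IntegrableOn (fun y : ℝ => (2 * ((t + 1) / t * (y * (t * y + 1)))) ^ α *
      Real.exp (-(t * y))) (Ioi 0) := by
    have h := (integrableOn_Ioi_comp_mul_left_iff
      (fun w : ℝ => (2 * (w * (w + 1))) ^ α * Real.exp (-w)) 0 ht).2
      (by simpa using integrableOn_endpoint_majorant hα)
    refine IntegrableOn.congr_fun (h.const_mul (((t + 1) / t ^ 2) ^ α)) ?_ measurableSet_Ioi
    intro y hy
    have hy : 0 < y := hy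
    have hp : 0 < t * y * (t * y + 1) := by positivity
    beta_reduce
    rw [← mul_assoc, ← Real.mul_rpow (by positivity) (by positivity)]
    congr 2
    field_simp
  -- The majorant dominates because `y + 1 ≤ (1 + 1/t) (ty + 1)`.
  refine h0.mono' ?_ ?_
  · refine Continuous.aestronglyMeasurable ?_
    rw [continuous_iff_continuousAt]
    intro y
    exact ContinuousAt.comp (f := fun y : ℝ => (1 + y * I : ℂ))
      (continuousAt_oscIntegrand hα t (by simp)) (by fun_prop)
  · refine (ae_restrict_iff' measurableSet_Ioi).2 (Eventually.of_forall fun y hy => ?_)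
    have hy : 0 < y := hy
    have h := norm_mul_sq_sub_le hy.le zero_le_one le_rfl
    rw [Complex.ofReal_one, one_mul] at h
    rw [oscIntegrand_one_add, norm_mul, norm_mul, Complex.norm_cpow_real, Complex.norm_real,
      Real.norm_of_nonneg (Real.exp_pos _).le, mul_comm I, Complex.norm_exp_ofReal_mul_I, one_mul,
      neg_mul]
    gcongr
    refine h.trans ?_
    have : (t + 1) / t * (y * (t * y + 1)) = y * (t * y + 1) * (1 + 1 / t) := by
      field_simp
    rw [this]
    have : y * (t * y + 1) * (1 + 1 / t) = y * (t * y + 1 + y + 1 / t) := by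
      field_simp; ring
    rw [this]
    have : 0 < 1 / t := by positivity
    refine mul_le_mul_of_nonneg_left (mul_le_mul_of_nonneg_left ?_ hy.le) zero_le_two
    nlinarith [mul_pos ht hy]

lemma integral_oscIntegrand_one_add (α t : ℝ) :
    ∫ y in Ioi (0 : ℝ), oscIntegrand α t (1 + y * I) = cexp (I * t) * endpointIntegral α t := by
  simp_rw [oscIntegrand_one_add]
  rw [integral_const_mul, endpointIntegral]

/-- The integral over the horizontal side at height `R` vanishes in the limit. -/
lemma tendsto_integral_oscIntegrand_top {α t : ℝ} (hα : 0 < α) (ht : 0 < t) :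
    Tendsto (fun R : ℝ => ∫ x in (-1 : ℝ)..1, oscIntegrand α t (x + R * I)) atTop (𝓝 0) := by
  have h1 : Tendsto (fun R : ℝ => 2 * (16 ^ α * (R ^ (2 * α) * Real.exp (-t * R)))) atTop
      (𝓝 0) := by
    have := tendsto_rpow_mul_exp_neg_mul_atTop_nhds_zero (2 * α) t ht
    simpa using (this.const_mul (16 ^ α)).const_mul 2
  refine squeeze_zero_norm' ?_ h1
  filter_upwards [eventually_ge_atTop 1] with R hR
  have : ∀ x ∈ Set.uIoc (-1 : ℝ) 1, ‖oscIntegrand α t (x + R * I)‖ ≤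
      16 ^ α * (R ^ (2 * α) * Real.exp (-t * R)) := by
    intro x hx
    rw [Set.uIoc_of_le (by norm_num)] at hx
    rw [norm_oscIntegrand, ← mul_assoc]
    have e : (16 : ℝ) ^ α * R ^ (2 * α) = (16 * R ^ 2) ^ α := by
      rw [Real.mul_rpow (by norm_num) (by positivity), Real.rpow_mul (by linarith)]; norm_num
    rw [e]
    have hn : ‖(x + R * I : ℂ)‖ ≤ 2 * R := by
      refine (norm_add_le _ _).trans ?_
      have : |x| ≤ 1 := abs_le.2 ⟨hx.1.le, hx.2⟩
      simp [abs_of_nonneg (by linarith : 0 ≤ R)]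
      linarith
    have hb : ‖(1 - (x + R * I) ^ 2 : ℂ)‖ ≤ 16 * R ^ 2 := by
      refine (norm_sub_le _ _).trans ?_
      rw [norm_pow, norm_one]
      have := pow_le_pow_left₀ (norm_nonneg _) hn 2
      nlinarith
    have hi : (x + R * I : ℂ).im = R := by simp
    rw [hi]
    gcongr
  have := intervalIntegral.norm_integral_le_of_norm_le_const this
  refine this.trans (le_of_eq ?_)
  norm_num
  ring

/-- Shifting the contour from `[-1, 1]` to the two vertical half lines above `±1`. -/
lemma oscIntegral_eq {α t : ℝ} (hα : 0 < α) (ht : 0 < t) :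
    oscIntegral α t = ((2 * (cexp (I * t) * endpointIntegral α t).im : ℝ) : ℂ) := by
  set A := cexp (I * t) * endpointIntegral α t with hA
  have rect : ∀ R : ℝ, oscIntegral α t - (∫ x in (-1 : ℝ)..1, oscIntegrand α t (x + R * I))
      + I * (∫ y in (0 : ℝ)..R, oscIntegrand α t (1 + y * I))
      - I * (∫ y in (0 : ℝ)..R, (starRingEnd ℂ) (oscIntegrand α t (1 + y * I))) = 0 := by
    intro R
    have h := Complex.integral_boundary_rect_eq_zero_of_continuousOn_of_differentiableOn
      (oscIntegrand α t) (-1) (1 + R * I) ?_ ?_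
    · have e : ∫ y in (0 : ℝ)..R, oscIntegrand α t (-1 + y * I) =
          ∫ y in (0 : ℝ)..R, (starRingEnd ℂ) (oscIntegrand α t (1 + y * I)) := by
        exact intervalIntegral.integral_congr fun y _ => oscIntegrand_neg_one_add α t y
      rw [← e]
      simpa [oscIntegral] using h
    · intro z hz
      refine (continuousAt_oscIntegrand hα t ?_).continuousWithinAt
      have := hz.1
      simp [Set.uIcc_of_le] at this
      exact abs_le.2 this
    · intro z hz
      refine (differentiableAt_oscIntegrand α t ?_).differentiableWithinAt
      have := hz.1
      simp at this
      exact abs_lt.2 this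
  have hI := integrableOn_oscIntegrand_one_add hα ht
  have l1 := intervalIntegral_tendsto_integral_Ioi 0 hI tendsto_id
  have hI2 : IntegrableOn (fun y : ℝ => (starRingEnd ℂ) (oscIntegrand α t (1 + y * I))) (Ioi 0) :=
    (Complex.conjCLE.toContinuousLinearMap).integrable_comp hI
  have l2 := intervalIntegral_tendsto_integral_Ioi 0 hI2 tendsto_id
  rw [integral_conj] at l2
  rw [integral_oscIntegrand_one_add, ← hA] at l1 l2
  have l3 := tendsto_integral_oscIntegrand_top hα ht
  have l4 := ((tendsto_const_nhds (x := oscIntegral α t)).sub l3 |>.add (l1.const_mul I)).sub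
    (l2.const_mul I)
  have l5 : oscIntegral α t - 0 + I * A - I * (starRingEnd ℂ) A = 0 := by
    refine tendsto_nhds_unique l4 (tendsto_const_nhds.congr' ?_)
    exact Eventually.of_forall fun R => (rect R).symm
  have l6 : oscIntegral α t = -(I * (A - (starRingEnd ℂ) A)) := by linear_combination l5
  rw [l6, Complex.sub_conj]
  push_cast
  linear_combination (-2 * (A.im : ℂ)) * Complex.I_sq

/-- The leading asymptotics of `oscIntegral`: the phase comes from the branch `(-2i)^α`. -/
lemma tendsto_oscIntegral_sub {α : ℝ} (hα : 0 < α) :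
    Tendsto (fun t : ℝ => t ^ (α + 1) * (oscIntegral α t).re -
      2 * (2 ^ α * Real.Gamma (α + 1)) * Real.sin (t - Real.pi * α / 2)) atTop (𝓝 0) := by
  have h := (tendsto_endpointIntegral hα).sub_const (endpointLimit α)
  rw [sub_self] at h
  have h2 := h.norm.const_mul 2
  rw [norm_zero, mul_zero] at h2
  refine squeeze_zero_norm' ?_ h2
  filter_upwards [eventually_gt_atTop 0] with t ht
  have e1 : (cexp (I * t) * endpointLimit α).im =
      2 ^ α * Real.Gamma (α + 1) * Real.sin (t - Real.pi * α / 2) := by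
    rw [endpointLimit_eq hα, mul_left_comm, ← Complex.exp_add]
    have : I * t + -((Real.pi * α / 2 : ℝ) : ℂ) * I = ((t - Real.pi * α / 2 : ℝ) : ℂ) * I := by
      push_cast; ring
    rw [this, Complex.im_ofReal_mul, Complex.exp_ofReal_mul_I_im]
  rw [oscIntegral_eq hα ht, Complex.ofReal_re, mul_assoc 2, ← e1]
  have e2 : t ^ (α + 1) * (2 * (cexp (I * t) * endpointIntegral α t).im) -
      2 * (cexp (I * t) * endpointLimit α).im =
      2 * (cexp (I * t) *
        (((t ^ (α + 1) : ℝ) : ℂ) * endpointIntegral α t - endpointLimit α)).im := by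
    rw [mul_sub, mul_left_comm (cexp _), Complex.sub_im, Complex.im_ofReal_mul]
    ring
  rw [e2, norm_mul, Real.norm_ofNat]
  gcongr
  refine (Complex.abs_im_le_norm _).trans ?_
  rw [norm_mul, mul_comm I, Complex.norm_exp_ofReal_mul_I, one_mul]

/-- The two sines with phase `β` at `t` and `2t` are not simultaneously small, unless
`sin β = 0`. -/
lemma sin_sq_le_sin_sub_sq (t β : ℝ) :
    Real.sin β ^ 2 ≤ 17 * (Real.sin (t - β) ^ 2 + Real.sin (2 * t - β) ^ 2) := by
  have e : Real.sin (2 * t - β) = 2 * Real.sin (t - β) * Real.cos (t - β) * Real.cos β +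
      (1 - 2 * Real.sin (t - β) ^ 2) * Real.sin β := by
    have : 2 * t - β = 2 * (t - β) + β := by ring
    rw [this, Real.sin_add, Real.sin_two_mul, Real.cos_two_mul, Real.cos_sq']
    ring
  set u := Real.sin (t - β)
  set v := Real.sin (2 * t - β)
  have e2 : Real.sin β = v - 2 * u * (Real.cos (t - β) * Real.cos β - u * Real.sin β) := by
    rw [e]; ring
  have e3 : Real.cos (t - β) * Real.cos β - u * Real.sin β = Real.cos t := by
    rw [← Real.cos_add]; ring_nf
  rw [e3] at e2
  rw [e2]
  nlinarith [sq_nonneg (4 * v + u), Real.cos_sq_le_one t, Real.neg_one_le_cos t, Real.cos_le_one t,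
    sq_nonneg u, mul_nonneg (sq_nonneg u) (sub_nonneg.2 (Real.cos_sq_le_one t)),
    sq_nonneg (v + 2 * u * Real.cos t)]

/-- If `α` is not an even integer, the Fourier transform of `(1 - s²)^α` has its expected size at
one of `t`, `2t`, for every large `t`. -/
theorem exists_le_oscIntegral_sq {α : ℝ} (hα : 0 < α) (hs : Real.sin (Real.pi * α / 2) ≠ 0) :
    ∃ t₀ c : ℝ, 0 < t₀ ∧ 0 < c ∧ ∀ t, t₀ ≤ t →
      c ≤ (t ^ (α + 1) * ‖oscIntegral α t‖) ^ 2 +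
        ((2 * t) ^ (α + 1) * ‖oscIntegral α (2 * t)‖) ^ 2 := by
  set β := Real.pi * α / 2
  set K := 2 * (2 ^ α * Real.Gamma (α + 1))
  have hK : 0 < K := by
    have := Real.Gamma_pos_of_pos (show 0 < α + 1 by linarith)
    positivity
  have hs2 : 0 < Real.sin β ^ 2 := by positivity
  set ε := K ^ 2 * Real.sin β ^ 2 / 17 / 8
  have hε : 0 < ε := by positivity
  have h := tendsto_oscIntegral_sub hα
  have h' := h.norm.pow 2
  rw [norm_zero, zero_pow two_ne_zero] at h'
  have h'' : ∀ᶠ t in atTop, _ := h'.eventually (gt_mem_nhds hε)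
  obtain ⟨t₁, ht₁⟩ := eventually_atTop.1 h''
  have key : ∀ t, max t₁ 1 ≤ t → K ^ 2 * Real.sin (t - β) ^ 2 ≤
      2 * (t ^ (α + 1) * ‖oscIntegral α t‖) ^ 2 + 2 * ε := by
    intro t ht
    have a := (ht₁ t ((le_max_left _ _).trans ht)).le
    have ht0 : 0 < t := lt_of_lt_of_le (by norm_num) ((le_max_right _ _).trans ht)
    rw [Real.norm_eq_abs, sq_abs] at a
    have b : (t ^ (α + 1) * (oscIntegral α t).re) ^ 2 ≤ (t ^ (α + 1) * ‖oscIntegral α t‖) ^ 2 := by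
      rw [mul_pow, mul_pow]
      refine mul_le_mul_of_nonneg_left ?_ (sq_nonneg _)
      rw [← sq_abs (oscIntegral α t).re]
      gcongr
      exact Complex.abs_re_le_norm _
    set x := t ^ (α + 1) * (oscIntegral α t).re
    nlinarith [sq_nonneg (2 * x - K * Real.sin (t - β))]
  refine ⟨max t₁ 1, 2 * ε, by positivity, by positivity, fun t ht => ?_⟩
  have ht0 : 0 < t := lt_of_lt_of_le (by norm_num) ((le_max_right _ _).trans ht)
  have a := key t ht
  have b := key (2 * t) (by linarith)
  have c := sin_sq_le_sin_sub_sq t β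
  have c' := mul_le_mul_of_nonneg_left c (sq_nonneg K)
  have : K ^ 2 * Real.sin β ^ 2 = 17 * 8 * ε := by simp only [ε]; ring
  rw [this] at c'
  nlinarith

/-! ### The Fourier transform of a Euclidean ball -/

/-- The volume of the Euclidean unit ball of `ℝ^n`. -/
def unitBallVolume (n : ℕ) : ℝ := volume.real (Metric.ball (0 : EuclideanSpace ℝ (Fin n)) 1)

lemma unitBallVolume_pos (n : ℕ) : 0 < unitBallVolume n :=
  ENNReal.toReal_pos (Metric.measure_ball_pos _ _ one_pos).ne' measure_ball_lt_top.ne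

lemma volume_real_ball (n : ℕ) {r : ℝ} (hr : 0 < r) :
    volume.real (Metric.ball (0 : EuclideanSpace ℝ (Fin n)) r) = r ^ n * unitBallVolume n := by
  rw [Measure.real, Measure.addHaar_ball_of_pos _ _ hr, ENNReal.toReal_mul,
    ENNReal.toReal_ofReal (by positivity), finrank_euclideanSpace_fin]
  rfl

lemma volume_real_sum_sq_lt (n : ℕ) {a : ℝ} (ha : 0 < a) :
    volume.real {y : Fin n → ℝ | ∑ i, y i ^ 2 < a} = a ^ ((n : ℝ) / 2) * unitBallVolume n := by
  have h : {y : Fin n → ℝ | ∑ i, y i ^ 2 < a} =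
      WithLp.toLp 2 ⁻¹' (Metric.ball (0 : EuclideanSpace ℝ (Fin n)) (Real.sqrt a)) := by
    ext y
    simp only [mem_ofPred_eq, mem_preimage, mem_ball_zero_iff, EuclideanSpace.norm_eq,
      Real.norm_eq_abs, sq_abs]
    rw [Real.sqrt_lt_sqrt_iff (Finset.sum_nonneg fun i _ => sq_nonneg _)]
  rw [h, Measure.real, (PiLp.volume_preserving_toLp (Fin n)).measure_preimage
    Metric.isOpen_ball.measurableSet.nullMeasurableSet, ← Measure.real,
    volume_real_ball n (Real.sqrt_pos.2 ha), Real.sqrt_eq_rpow, ← Real.rpow_natCast,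
    ← Real.rpow_mul ha.le]
  congr 2
  ring

/-- The coordinates `x ↦ (x₀, (x₁, …, x_n))` on `ℝ^(n+1)`. -/
def splitHead (n : ℕ) : EuclideanSpace ℝ (Fin (n + 1)) ≃ᵐ ℝ × (Fin n → ℝ) :=
  (MeasurableEquiv.toLp 2 (Fin (n + 1) → ℝ)).symm.trans
    (MeasurableEquiv.piFinSuccAbove (fun _ => ℝ) 0)

lemma measurePreserving_splitHead (n : ℕ) : MeasurePreserving (splitHead n) :=
  (PiLp.volume_preserving_ofLp (Fin (n + 1))).trans
    (volume_preserving_piFinSuccAbove (fun _ : Fin (n + 1) => ℝ) 0)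

lemma splitHead_apply (n : ℕ) (x : EuclideanSpace ℝ (Fin (n + 1))) :
    splitHead n x = (x 0, fun i => x i.succ) := rfl

lemma ball_eq_preimage_splitHead (n : ℕ) :
    Metric.ball (0 : EuclideanSpace ℝ (Fin (n + 1))) 1 =
      splitHead n ⁻¹' {q | q.1 ^ 2 + ∑ i, q.2 i ^ 2 < 1} := by
  ext x
  simp only [mem_ball_zero_iff, mem_preimage, mem_ofPred_eq, splitHead_apply]
  rw [EuclideanSpace.norm_eq, Real.sqrt_lt' one_pos, Fin.sum_univ_succ]
  simp

/-- Slicing the unit ball perpendicularly to the first coordinate axis. -/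
lemma integral_unitBall_exp_head (n : ℕ) (τ : ℝ) :
    ∫ x in Metric.ball (0 : EuclideanSpace ℝ (Fin (n + 1))) 1, cexp (I * τ * x 0) =
      unitBallVolume n * oscIntegral (n / 2) τ := by
  set S : Set (ℝ × (Fin n → ℝ)) := {q | q.1 ^ 2 + ∑ i, q.2 i ^ 2 < 1} with hS
  have hSm : MeasurableSet S := by
    apply (isOpen_lt (by fun_prop) (by fun_prop)).measurableSet
  have hvol : volume S < ⊤ := by
    rw [← (measurePreserving_splitHead n).measure_preimage hSm.nullMeasurableSet,
      ← ball_eq_preimage_splitHead]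
    exact measure_ball_lt_top
  have h1 : ∫ x in Metric.ball (0 : EuclideanSpace ℝ (Fin (n + 1))) 1, cexp (I * τ * x 0) =
      ∫ q in S, cexp (I * τ * q.1) := by
    rw [ball_eq_preimage_splitHead, ← (measurePreserving_splitHead n).setIntegral_preimage_emb
      (splitHead n).measurableEmbedding]
    rfl
  have hint : Integrable (S.indicator fun q : ℝ × (Fin n → ℝ) => cexp (I * τ * q.1))
      ((volume : Measure ℝ).prod volume) := by
    rw [integrable_indicator_iff hSm]
    have : IntegrableOn (fun _ : ℝ × (Fin n → ℝ) => (1 : ℝ)) S := integrableOn_const hvol.ne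
    refine this.mono' (by fun_prop) (Eventually.of_forall fun q => ?_)
    rw [mul_assoc, mul_comm I, ← Complex.ofReal_mul, Complex.norm_exp_ofReal_mul_I]
  rw [h1, ← integral_indicator hSm, Measure.volume_eq_prod, integral_prod _ hint, oscIntegral,
    intervalIntegral.integral_of_le (by norm_num), integral_Ioc_eq_integral_Ioo,
    ← integral_const_mul, ← integral_indicator measurableSet_Ioo]
  refine integral_congr_ae (Eventually.of_forall fun s => ?_)
  beta_reduce
  have h2 : ∀ y : Fin n → ℝ, S.indicator (fun q : ℝ × (Fin n → ℝ) => cexp (I * τ * q.1)) (s, y) =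
      {y : Fin n → ℝ | ∑ i, y i ^ 2 < 1 - s ^ 2}.indicator (fun _ => cexp (I * τ * s)) y := by
    intro y
    have : (s, y) ∈ S ↔ y ∈ {y : Fin n → ℝ | ∑ i, y i ^ 2 < 1 - s ^ 2} := by
      simp only [hS, mem_ofPred_eq]
      constructor <;> intro h <;> linarith
    by_cases hy : (s, y) ∈ S
    · rw [indicator_of_mem hy, indicator_of_mem (this.1 hy)]
    · rw [indicator_of_notMem hy, indicator_of_notMem (fun h => hy (this.2 h))]
  simp_rw [h2]
  have hm : MeasurableSet {y : Fin n → ℝ | ∑ i, y i ^ 2 < 1 - s ^ 2} := by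
    apply (isOpen_lt (by fun_prop) (by fun_prop)).measurableSet
  rw [integral_indicator_const _ hm]
  by_cases hs : s ∈ Ioo (-1 : ℝ) 1
  · have h0 : 0 < 1 - s ^ 2 := by nlinarith [hs.1, hs.2]
    rw [indicator_of_mem hs, volume_real_sum_sq_lt n h0, oscIntegrand]
    have : (1 - (s : ℂ) ^ 2) = ((1 - s ^ 2 : ℝ) : ℂ) := by push_cast; ring
    rw [this, ← Complex.ofReal_cpow h0.le, Complex.real_smul]
    push_cast
    ring
  · rw [indicator_of_notMem hs]
    have : {y : Fin n → ℝ | ∑ i, y i ^ 2 < 1 - s ^ 2} = ∅ := by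
      refine eq_empty_of_forall_notMem fun y hy => hs ?_
      have hy : ∑ i, y i ^ 2 < 1 - s ^ 2 := hy
      have h3 : 0 ≤ ∑ i, y i ^ 2 := Finset.sum_nonneg fun i _ => sq_nonneg _
      have h4 : s ^ 2 < 1 := by linarith
      exact abs_lt.1 ((sq_lt_one_iff_abs_lt_one _).1 h4)
    rw [this]
    simp

lemma integral_unitBall_exp_inner {n : ℕ} (ξ : EuclideanSpace ℝ (Fin (n + 1))) :
    ∫ x in Metric.ball (0 : EuclideanSpace ℝ (Fin (n + 1))) 1, cexp (I * (inner ℝ ξ x : ℝ)) =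
      unitBallVolume n * oscIntegral (n / 2) ‖ξ‖ := by
  set e : EuclideanSpace ℝ (Fin (n + 1)) := EuclideanSpace.single 0 ‖ξ‖ with he
  have hne : ‖ξ‖ = ‖e‖ := by simp [he]
  set R : EuclideanSpace ℝ (Fin (n + 1)) ≃ₗᵢ[ℝ] EuclideanSpace ℝ (Fin (n + 1)) :=
    (Submodule.span ℝ {ξ - e})ᗮ.reflection
  have hR : R ξ = e := Submodule.reflection_sub hne
  have hball : Metric.ball (0 : EuclideanSpace ℝ (Fin (n + 1))) 1 =
      R ⁻¹' Metric.ball (0 : EuclideanSpace ℝ (Fin (n + 1))) 1 := by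
    ext x; simp
  have hmp : MeasurePreserving R volume volume := LinearIsometryEquiv.measurePreserving R
  rw [← integral_unitBall_exp_head, ← hmp.setIntegral_preimage_emb
    R.toHomeomorph.measurableEmbedding (fun x => cexp (I * ‖ξ‖ * x 0)), ← hball]
  refine integral_congr_ae (Eventually.of_forall fun x => ?_)
  beta_reduce
  rw [← R.inner_map_map ξ x, hR, he, EuclideanSpace.inner_single_left]
  simp [mul_assoc]

/-- The Fourier transform of the indicator function of a ball. -/
theorem integral_ball_exp_inner {n : ℕ} {ρ : ℝ} (hρ : 0 < ρ)
    (ξ : EuclideanSpace ℝ (Fin (n + 1))) :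
    ∫ x in Metric.ball (0 : EuclideanSpace ℝ (Fin (n + 1))) ρ, cexp (I * (inner ℝ ξ x : ℝ)) =
      ρ ^ (n + 1) * (unitBallVolume n * oscIntegral (n / 2) (ρ * ‖ξ‖)) := by
  have h := Measure.setIntegral_comp_smul_of_pos (volume : Measure (EuclideanSpace ℝ (Fin (n + 1))))
    (fun x => cexp (I * (inner ℝ ξ x : ℝ))) (Metric.ball 0 1) hρ
  rw [smul_unitBall_of_pos hρ, finrank_euclideanSpace_fin] at h
  have h2 := integral_unitBall_exp_inner (ρ • ξ)
  rw [norm_smul, Real.norm_of_nonneg hρ.le] at h2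
  simp_rw [inner_smul_left, inner_smul_right] at h h2
  simp only [conj_trivial] at h2
  rw [h2] at h
  rw [h, Complex.real_smul]
  have : (ρ : ℂ) ≠ 0 := by exact_mod_cast hρ.ne'
  push_cast
  field_simp

/-! ### Integration on the torus and the grid -/

/-- The Haar probability measure of the torus, written as a product so that it agrees by definition
with the measure in Mathlib's Fourier series on `UnitAddTorus`. -/
abbrev torusHaar (d : ℕ) : Measure (UnitAddTorus (Fin d)) :=
  Measure.pi fun _ => AddCircle.haarAddCircle

instance : (AddCircle.haarAddCircle (T := (1 : ℝ))).Regular := by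
  unfold AddCircle.haarAddCircle; infer_instance

instance : (AddCircle.haarAddCircle (T := (1 : ℝ))).IsNegInvariant := by infer_instance

instance {d : ℕ} : (torusHaar d).IsNegInvariant := Measure.pi.isNegInvariant _

/-- The fundamental domain `(-1/2, 1/2]^d` of the torus. -/
def unitCube (d : ℕ) : Set (Fin d → ℝ) := {x | ∀ i, x i ∈ Ioc (-1 / 2 : ℝ) (-1 / 2 + 1)}

lemma integral_torusHaar {d : ℕ} {E : Type*} [NormedAddCommGroup E] [NormedSpace ℝ E]
    (f : UnitAddTorus (Fin d) → E) :
    ∫ x, f x ∂(torusHaar d) = ∫ x in unitCube d, f (fun i => x i) :=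
  UnitAddTorus.integral_preimage f _

lemma lintegral_torusHaar {d : ℕ} (f : UnitAddTorus (Fin d) → ENNReal) :
    ∫⁻ x, f x ∂(torusHaar d) = ∫⁻ x in unitCube d, f (fun i => x i) :=
  UnitAddTorus.lintegral_preimage f _

lemma measurableSet_unitCube (d : ℕ) : MeasurableSet (unitCube d) :=
  MeasurableSet.univ_pi' fun _ => measurableSet_Ioc

lemma isOpenMap_toTorus {d : ℕ} : IsOpenMap (toTorus (d := d)) := by
  have h1 : IsOpenMap (fun x : Fin d → ℝ => fun i => (x i : UnitAddCircle)) :=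
    IsOpenMap.piMap (fun i => QuotientAddGroup.isOpenMap_coe)
      (Eventually.of_forall fun i => QuotientAddGroup.mk_surjective)
  exact h1.comp (PiLp.homeomorph 2 (fun _ => ℝ)).isOpenMap

lemma toTorus_add {d : ℕ} (x y : EuclideanSpace ℝ (Fin d)) :
    toTorus (x + y) = toTorus x + toTorus y := by
  ext i; simp [toTorus]

lemma toTorus_sub {d : ℕ} (x y : EuclideanSpace ℝ (Fin d)) :
    toTorus (x - y) = toTorus x - toTorus y := by
  ext i; simp [toTorus]

lemma toTorus_eq_iff {d : ℕ} {x y : EuclideanSpace ℝ (Fin d)} :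
    toTorus x = toTorus y ↔ ∃ k : Fin d → ℤ, ∀ i, y i = x i + k i := by
  have : ∀ i, ((x i : UnitAddCircle) = y i ↔ ∃ k : ℤ, y i = x i + k) := by
    intro i
    rw [eq_comm, QuotientAddGroup.eq_iff_sub_mem, AddSubgroup.mem_zmultiples_iff]
    constructor
    · rintro ⟨k, hk⟩
      exact ⟨k, by simp at hk; linarith⟩
    · rintro ⟨k, hk⟩
      exact ⟨k, by simp; linarith⟩
  rw [funext_iff]
  simp only [toTorus]
  simp_rw [this]
  exact Classical.skolem

lemma isOpen_torusBall (d : ℕ) (ρ : ℝ) : IsOpen (torusBall d ρ) :=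
  isOpenMap_toTorus _ Metric.isOpen_ball

lemma measurableSet_torusBall (d : ℕ) (ρ : ℝ) : MeasurableSet (torusBall d ρ) :=
  (isOpen_torusBall d ρ).measurableSet

/-- A ball of radius at most `1/2` lies in the fundamental cube, so membership in the torus ball
can be read off from the representative in that cube. -/
lemma toTorus_mem_torusBall_iff {d : ℕ} {ρ : ℝ} (hρ : ρ ≤ 1 / 2) {x : EuclideanSpace ℝ (Fin d)}
    (hx : WithLp.ofLp x ∈ unitCube d) : toTorus x ∈ torusBall d ρ ↔ ‖x‖ < ρ := by
  constructor
  · rintro ⟨v, hv, hvx⟩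
    rw [mem_ball_zero_iff] at hv
    obtain ⟨k, hk⟩ := toTorus_eq_iff.1 hvx
    suffices x = v by rw [this]; exact hv
    ext i
    have h1 := hx i
    have h2 := abs_lt.1 ((Real.norm_eq_abs _).symm.trans_le (PiLp.norm_apply_le v i) |>.trans_lt hv)
    have h3 := hk i
    have h4 : (-1 : ℝ) < k i := by linarith [h1.1]
    have h5 : (k i : ℝ) < 1 := by linarith [h1.2]
    have h6 : k i = 0 := by
      have a : (-1 : ℤ) < k i := by exact_mod_cast h4
      have b : k i < 1 := by exact_mod_cast h5
      omega
    rw [h3, h6]; simp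
  · intro h
    exact ⟨x, by simpa using h, rfl⟩

/-- The lift of a point of the torus to the fundamental cube. -/
def cubeLift {d : ℕ} (y : UnitAddTorus (Fin d)) : Fin d → ℝ :=
  fun i => AddCircle.measurableEquivIoc 1 (-1 / 2) (y i)

lemma measurable_cubeLift {d : ℕ} : Measurable (cubeLift (d := d)) :=
  measurable_pi_lambda _ fun i => measurable_subtype_coe.comp
    ((AddCircle.measurableEquivIoc 1 (-1 / 2)).measurable.comp (measurable_pi_apply i))

lemma toTorus_cubeLift {d : ℕ} (y : UnitAddTorus (Fin d)) :
    toTorus (WithLp.toLp 2 (cubeLift y)) = y := by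
  ext i
  exact (AddCircle.measurableEquivIoc 1 (-1 / 2)).symm_apply_apply (y i)

lemma cubeLift_coe {d : ℕ} {x : Fin d → ℝ} (hx : x ∈ unitCube d) :
    cubeLift (fun i => (x i : UnitAddCircle)) = x := by
  ext i
  exact congrArg Subtype.val
    ((AddCircle.measurableEquivIoc 1 (-1 / 2)).apply_symm_apply ⟨x i, hx i⟩)

/-- The index `j` of the cell `∏ (j_i/M, (j_i+1)/M]` that contains the lift of `y`. The cells are
open on the left because the fundamental cube is. -/
def gridRound {d : ℕ} (M : ℕ) (y : UnitAddTorus (Fin d)) : Fin d → ℤ :=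
  fun i => ⌈(M : ℝ) * cubeLift y i⌉ - 1

lemma measurable_gridRound {d : ℕ} (M : ℕ) : Measurable (gridRound (d := d) M) := by
  refine measurable_pi_lambda _ fun i => ?_
  exact (Int.measurable_ceil.comp
    (((measurable_pi_apply i).comp measurable_cubeLift).const_mul _)).sub_const _

/-- A point differs from the corner of its cell by a vector of norm at most `d / M`. -/
lemma exists_sub_gridPoint_gridRound {d : ℕ} {M : ℕ} (hM : 0 < M) (y : UnitAddTorus (Fin d)) :
    ∃ e : EuclideanSpace ℝ (Fin d), ‖e‖ ≤ d / M ∧ y - gridPoint M (gridRound M y) = toTorus e := by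
  refine ⟨WithLp.toLp 2 (cubeLift y) - WithLp.toLp 2 fun i => (gridRound M y i : ℝ) / M, ?_, ?_⟩
  · have hM' : (0 : ℝ) < M := by exact_mod_cast hM
    set e := WithLp.toLp 2 (cubeLift y) - WithLp.toLp 2 fun i => (gridRound M y i : ℝ) / M with he
    have hb : ∀ i, |e i| ≤ 1 / M := by
      intro i
      have h1 := Int.ceil_lt_add_one ((M : ℝ) * cubeLift y i)
      have h2 := Int.le_ceil ((M : ℝ) * cubeLift y i)
      have h3 : e i = (M * cubeLift y i - (⌈(M : ℝ) * cubeLift y i⌉ - 1)) / M := by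
        simp only [he, PiLp.sub_apply, gridRound]
        push_cast
        field_simp
      rw [h3, abs_div, abs_of_pos hM']
      gcongr
      rw [abs_le]; constructor <;> linarith
    have h4 : ‖e‖ ^ 2 ≤ ((d : ℝ) / M) ^ 2 := by
      rw [EuclideanSpace.norm_sq_eq]
      calc ∑ i, ‖e i‖ ^ 2 ≤ ∑ _i : Fin d, (1 / (M : ℝ)) ^ 2 := by
            gcongr with i; exact hb i
        _ = d * (1 / (M : ℝ)) ^ 2 := by simp
        _ ≤ (d : ℝ) ^ 2 * (1 / (M : ℝ)) ^ 2 := by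
            gcongr; exact_mod_cast Nat.le_self_pow two_ne_zero d
        _ = _ := by ring
    exact le_of_sq_le_sq h4 (by positivity)
  · rw [toTorus_sub, toTorus_cubeLift]; rfl

/-- The average over the grid is the integral over the torus of the function that is constant on
the cells of the grid; the cells tile the fundamental cube because `M` is even. -/
lemma integral_gridRound {d M : ℕ} (hM : 0 < M) (hMe : Even M) (g : (Fin d → ℤ) → ℝ) :
    ∫ y, g (gridRound M y) ∂(torusHaar d) =
      1 / (M : ℝ) ^ d * ∑ j ∈ Fintype.piFinset (fun _ : Fin d => gridIndices M), g j := by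
  have hM' : (0 : ℝ) < M := by exact_mod_cast hM
  obtain ⟨K, hK⟩ := hMe
  have hK' : (M : ℝ) = 2 * K := by rw [hK]; push_cast; ring
  let cell : (Fin d → ℤ) → Set (Fin d → ℝ) := fun j =>
    Set.pi univ fun i => Ioc ((j i : ℝ) / M) ((j i + 1 : ℝ) / M)
  have hcell : ∀ j x, x ∈ cell j ↔ ∀ i, ⌈(M : ℝ) * x i⌉ - 1 = j i := by
    intro j x
    simp only [cell, mem_univ_pi, mem_Ioc, div_lt_iff₀ hM', le_div_iff₀ hM']
    refine forall_congr' fun i => ?_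
    rw [sub_eq_iff_eq_add, Int.ceil_eq_iff]
    push_cast
    rw [mul_comm (x i), add_sub_cancel_right]
  have hmem : ∀ j : ℤ, j ∈ gridIndices M ↔ -(K : ℤ) ≤ j ∧ j < K := by
    intro j
    rw [mem_gridIndices, hK']
    have e1 : -(2 * (K : ℝ)) / 2 = ((-(K : ℤ) : ℤ) : ℝ) := by push_cast; ring
    have e2 : (2 * (K : ℝ)) / 2 = (((K : ℤ) : ℤ) : ℝ) := by push_cast; ring
    rw [e1, e2, Int.cast_le, Int.cast_lt]
  have hcube : unitCube d = ⋃ j ∈ Fintype.piFinset (fun _ : Fin d => gridIndices M), cell j := by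
    ext x
    simp only [mem_iUnion, hcell, Fintype.mem_piFinset, exists_prop, hmem]
    have : ∀ i, x i ∈ Ioc (-1 / 2 : ℝ) (-1 / 2 + 1) ↔
        -(K : ℤ) ≤ ⌈(M : ℝ) * x i⌉ - 1 ∧ ⌈(M : ℝ) * x i⌉ - 1 < K := by
      intro i
      have a : -(K : ℤ) ≤ ⌈(M : ℝ) * x i⌉ - 1 ↔ ((-(K : ℤ) : ℤ) : ℝ) < M * x i := by
        rw [← Int.lt_ceil]; omega
      have b : ⌈(M : ℝ) * x i⌉ - 1 < K ↔ (M : ℝ) * x i ≤ ((K : ℤ) : ℝ) := by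
        rw [← Int.ceil_le]; omega
      rw [a, b, mem_Ioc]
      have hK0 : (0 : ℝ) < K := by linarith
      push_cast
      rw [hK']
      constructor
      · rintro ⟨h1, h2⟩
        constructor <;> nlinarith
      · rintro ⟨h1, h2⟩
        constructor
        · by_contra h; push Not at h; nlinarith
        · by_contra h; push Not at h; nlinarith
    constructor
    · intro hx
      exact ⟨_, fun i => (this i).1 (hx i), fun i => rfl⟩
    · rintro ⟨j, hj, hx⟩ i
      rw [this i, hx i]
      exact hj i
  have hmeas : ∀ j, MeasurableSet (cell j) := fun j =>
    MeasurableSet.univ_pi fun _ => measurableSet_Ioc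
  have hvol : ∀ j, volume.real (cell j) = 1 / (M : ℝ) ^ d := by
    intro j
    simp only [cell, Measure.real, Real.volume_pi_Ioc, ENNReal.toReal_prod]
    have : ∀ i, (ENNReal.ofReal ((j i + 1 : ℝ) / M - (j i : ℝ) / M)).toReal = 1 / M := by
      intro i
      rw [ENNReal.toReal_ofReal] <;> ring_nf
      positivity
    simp [this]
  have hfin : ∀ j, volume (cell j) ≠ ⊤ := by
    intro j h
    have hp : 0 < 1 / (M : ℝ) ^ d := by positivity
    rw [← hvol j, Measure.real, h] at hp
    simp at hp
  have hcongr : ∀ j, EqOn (fun x : Fin d → ℝ => g fun i => ⌈(M : ℝ) * x i⌉ - 1)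
      (fun _ => g j) (cell j) := by
    intro j x hx
    beta_reduce
    rw [funext ((hcell j x).1 hx)]
  rw [integral_torusHaar]
  have h1 : EqOn (fun x : Fin d → ℝ => g (gridRound M fun i => (x i : UnitAddCircle)))
      (fun x => g fun i => ⌈(M : ℝ) * x i⌉ - 1) (unitCube d) := by
    intro x hx
    beta_reduce
    unfold gridRound
    rw [cubeLift_coe hx]
  rw [setIntegral_congr_fun (measurableSet_unitCube d) h1, hcube,
    integral_biUnion_finset _ (fun j _ => hmeas j)]
  · rw [Finset.mul_sum]
    refine Finset.sum_congr rfl fun j _ => ?_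
    rw [setIntegral_congr_fun (hmeas j) (hcongr j), setIntegral_const, hvol, smul_eq_mul]
  · intro j _ j' _ hjj'
    refine Set.disjoint_left.2 fun x hx hx' => hjj' ?_
    ext i
    rw [← (hcell j x).1 hx i, ← (hcell j' x).1 hx' i]
  · intro j _
    exact (integrableOn_const (hfin j)).congr_fun (fun x hx => (hcongr j hx).symm) (hmeas j)

/-- Bessel's inequality for Fourier coefficients on the torus. -/
lemma sum_sq_norm_integral_mFourier_mul_le {d : ℕ} {f : UnitAddTorus (Fin d) → ℂ}
    (hf : MemLp f 2 (torusHaar d)) (s : Finset (Fin d → ℤ)) :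
    ∑ m ∈ s, ‖∫ x, UnitAddTorus.mFourier (-m) x * f x ∂(torusHaar d)‖ ^ 2 ≤
      ∫ x, ‖f x‖ ^ 2 ∂(torusHaar d) := by
  have h := UnitAddTorus.hasSum_sq_mFourierCoeff (hf.toLp f)
  have h1 := sum_le_hasSum s (fun _ _ => sq_nonneg _) h
  have h2 : ∀ m, UnitAddTorus.mFourierCoeff (hf.toLp f) m =
      ∫ x, UnitAddTorus.mFourier (-m) x * f x ∂(torusHaar d) := by
    intro m
    refine integral_congr_ae ?_
    filter_upwards [hf.coeFn_toLp] with x hx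
    rw [hx, smul_eq_mul]
  simp_rw [h2] at h1
  refine h1.trans (le_of_eq (integral_congr_ae ?_))
  filter_upwards [hf.coeFn_toLp] with x hx
  rw [hx]

/-! ### Fourier coefficients of balls in the torus -/

lemma norm_mFourier_apply {d : ℕ} (m : Fin d → ℤ) (x : UnitAddTorus (Fin d)) :
    ‖mFourier m x‖ = 1 := by
  simp only [mFourier, fourier_apply, ContinuousMap.coe_mk, norm_prod, Circle.norm_coe,
    Finset.prod_const_one]

lemma mFourier_sub_apply {d : ℕ} (m : Fin d → ℤ) (x y : UnitAddTorus (Fin d)) :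
    mFourier m (x - y) = mFourier m x * mFourier (-m) y := by
  simp only [mFourier, fourier_apply, ContinuousMap.coe_mk, Pi.sub_apply, Pi.neg_apply,
    ← Finset.prod_mul_distrib]
  refine Finset.prod_congr rfl fun i _ => ?_
  rw [smul_sub, sub_eq_add_neg, ← neg_smul, AddCircle.toCircle_add, Circle.coe_mul]

/-- The vector `2πm`. -/
def frequency {d : ℕ} (m : Fin d → ℤ) : EuclideanSpace ℝ (Fin d) :=
  WithLp.toLp 2 fun i => 2 * Real.pi * m i

lemma mFourier_toTorus {d : ℕ} (m : Fin d → ℤ) (x : EuclideanSpace ℝ (Fin d)) :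
    mFourier m (toTorus x) = cexp (I * (inner ℝ (frequency m) x : ℝ)) := by
  simp only [mFourier, ContinuousMap.coe_mk, toTorus, fourier_coe_apply, frequency,
    PiLp.inner_apply]
  rw [← Complex.exp_sum]
  congr 1
  push_cast
  rw [Finset.mul_sum]
  refine Finset.sum_congr rfl fun i _ => ?_
  simp
  ring

lemma continuous_mFourier {d : ℕ} (m : Fin d → ℤ) :
    Continuous fun x : UnitAddTorus (Fin d) => mFourier m x := (mFourier m).continuous

lemma integral_mFourier_eq_zero {d : ℕ} {m : Fin d → ℤ} (hm : m ≠ 0) :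
    ∫ x, mFourier m x ∂(torusHaar d) = 0 := by
  obtain ⟨i, hi⟩ := Function.ne_iff.1 hm
  have h := integral_fintype_prod_eq_prod
    (μ := fun _ : Fin d => AddCircle.haarAddCircle (T := (1 : ℝ)))
    (fun (i : Fin d) (x : AddCircle (1 : ℝ)) => (fourier (m i) x : ℂ))
  have h0 : ∫ x : AddCircle (1 : ℝ), (fourier (m i) x : ℂ) ∂AddCircle.haarAddCircle = 0 := by
    have := (orthonormal_iff_ite.mp (orthonormal_fourier (T := (1 : ℝ)))) 0 (m i)
    rw [if_neg (by simpa using hi.symm)] at this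
    simpa [ContinuousMap.inner_toLp] using this
  exact h.trans (Finset.prod_eq_zero (Finset.mem_univ i) h0)

/-- The indicator function of the ball of the torus. -/
def ballIndicator (d : ℕ) (ρ : ℝ) : UnitAddTorus (Fin d) → ℂ := (torusBall d ρ).indicator 1

lemma measurable_ballIndicator (d : ℕ) (ρ : ℝ) : Measurable (ballIndicator d ρ) :=
  measurable_one.indicator (measurableSet_torusBall d ρ)

lemma norm_ballIndicator_le (d : ℕ) (ρ : ℝ) (x : UnitAddTorus (Fin d)) :
    ‖ballIndicator d ρ x‖ ≤ 1 := by
  unfold ballIndicator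
  by_cases h : x ∈ torusBall d ρ <;> simp [h]

/-- The Fourier coefficient `∫_B e(m · x) dx` of the ball `B` of radius `ρ` in the torus; the sign
of the frequency is immaterial, as the ball is symmetric. -/
def ballCoeff (d : ℕ) (ρ : ℝ) (m : Fin d → ℤ) : ℂ :=
  ∫ x, mFourier m x * ballIndicator d ρ x ∂(torusHaar d)

lemma ballCoeff_eq_integral {d : ℕ} {ρ : ℝ} (hρ : ρ ≤ 1 / 2) (m : Fin d → ℤ) :
    ballCoeff d ρ m = ∫ x in Metric.ball (0 : EuclideanSpace ℝ (Fin d)) ρ,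
      cexp (I * (inner ℝ (frequency m) x : ℝ)) := by
  rw [ballCoeff, integral_torusHaar, ← integral_indicator (measurableSet_unitCube d),
    ← integral_indicator Metric.isOpen_ball.measurableSet,
    ← (PiLp.volume_preserving_ofLp (Fin d)).integral_comp
      (MeasurableEquiv.toLp 2 (Fin d → ℝ)).symm.measurableEmbedding]
  refine integral_congr_ae (Eventually.of_forall fun x => ?_)
  beta_reduce
  have hin : x ∈ Metric.ball (0 : EuclideanSpace ℝ (Fin d)) ρ → WithLp.ofLp x ∈ unitCube d := by
    intro h i
    rw [mem_ball_zero_iff] at h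
    have h2 := abs_lt.1 ((Real.norm_eq_abs _).symm.trans_le (PiLp.norm_apply_le x i) |>.trans_lt h)
    constructor <;> linarith [h2.1, h2.2]
  have hT : (fun i => ((WithLp.ofLp x i : ℝ) : UnitAddCircle)) = toTorus x := rfl
  by_cases hx : WithLp.ofLp x ∈ unitCube d
  · rw [indicator_of_mem hx, hT, mFourier_toTorus, ballIndicator]
    have hiff := toTorus_mem_torusBall_iff hρ hx
    by_cases hb : x ∈ Metric.ball (0 : EuclideanSpace ℝ (Fin d)) ρ
    · rw [indicator_of_mem hb, indicator_of_mem (hiff.2 (by simpa using hb))]; simp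
    · rw [indicator_of_notMem hb, indicator_of_notMem
        (fun h => hb (by simpa using hiff.1 h))]; simp
  · rw [indicator_of_notMem hx, indicator_of_notMem fun h => hx (hin h)]

lemma ballCoeff_eq {n : ℕ} {ρ : ℝ} (hρ0 : 0 < ρ) (hρ : ρ ≤ 1 / 2) (m : Fin (n + 1) → ℤ) :
    ballCoeff (n + 1) ρ m =
      ρ ^ (n + 1) * (unitBallVolume n * oscIntegral (n / 2) (ρ * ‖frequency m‖)) := by
  rw [ballCoeff_eq_integral hρ, integral_ball_exp_inner hρ0]

lemma integral_mFourier_mul_ballIndicator_sub {d : ℕ} (ρ : ℝ) (m : Fin d → ℤ)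
    (p : UnitAddTorus (Fin d)) :
    ∫ y, mFourier (-m) y * ballIndicator d ρ (p - y) ∂(torusHaar d) =
      mFourier (-m) p * ballCoeff d ρ m := by
  rw [ballCoeff, ← integral_const_mul]
  rw [← integral_sub_left_eq_self _ (torusHaar d) p]
  refine integral_congr_ae (Eventually.of_forall fun y => ?_)
  beta_reduce
  rw [sub_sub_cancel, mFourier_sub_apply, neg_neg, mul_assoc]

/-- The volume of a spherical shell bounds the measure of its image in the torus: each point of the
fundamental cube is met at most `3^d` times. -/
lemma torusHaar_image_le {d : ℕ} {A : Set (EuclideanSpace ℝ (Fin d))} (hA : IsOpen A)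
    (hA1 : ∀ x ∈ A, ‖x‖ < 3 / 2) :
    torusHaar d (toTorus '' A) ≤ 3 ^ d * volume A := by
  have hopen : MeasurableSet (toTorus '' A) := (isOpenMap_toTorus _ hA).measurableSet
  have hq : Measurable fun x : Fin d → ℝ => (fun i => x i : UnitAddTorus (Fin d)) :=
    measurable_pi_lambda _ fun i => AddCircle.measurable_mk'.comp (measurable_pi_apply i)
  rw [← lintegral_indicator_one hopen, lintegral_torusHaar]
  have h1 : ∀ x : Fin d → ℝ, (toTorus '' A).indicator (1 : UnitAddTorus (Fin d) → ENNReal)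
      (fun i => x i) = ((fun x : Fin d → ℝ => (fun i => x i : UnitAddTorus (Fin d))) ⁻¹'
        (toTorus '' A)).indicator 1 x := fun x => rfl
  simp_rw [h1]
  rw [lintegral_indicator_one (hq hopen), Measure.restrict_apply (hq hopen)]
  set T := Fintype.piFinset fun _ : Fin d => Finset.Icc (-1 : ℤ) 1 with hT
  have hsub : (fun x : Fin d → ℝ => (fun i => x i : UnitAddTorus (Fin d))) ⁻¹'
      (toTorus '' A) ∩ unitCube d ⊆
      ⋃ k ∈ T, (fun x : Fin d → ℝ => WithLp.toLp 2 (x + fun i => (k i : ℝ))) ⁻¹' A := by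
    rintro x ⟨⟨v, hv, hvx⟩, hx⟩
    have hvx' : toTorus (WithLp.toLp 2 x) = toTorus v := hvx.symm
    obtain ⟨k, hk⟩ := toTorus_eq_iff.1 hvx'
    have hk' : ∀ i, v i = x i + k i := hk
    simp only [mem_iUnion]
    refine ⟨k, ?_, ?_⟩
    · rw [hT, Fintype.mem_piFinset]
      intro i
      have h2 := abs_lt.1 ((Real.norm_eq_abs _).symm.trans_le (PiLp.norm_apply_le v i)
        |>.trans_lt (hA1 v hv))
      have h3 := hx i
      have a : (-2 : ℝ) < k i := by linarith [h3.2, hk' i, h2.1]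
      have b : (k i : ℝ) < 2 := by linarith [h3.1, hk' i, h2.2]
      have a' : (-2 : ℤ) < k i := by exact_mod_cast a
      have b' : k i < 2 := by exact_mod_cast b
      rw [Finset.mem_Icc]; omega
    · have : WithLp.toLp 2 (x + fun i => (k i : ℝ)) = v := by
        ext i; simp [hk' i]
      rw [mem_preimage, this]; exact hv
  refine (measure_mono hsub).trans ((measure_biUnion_finset_le _ _).trans (le_of_eq ?_))
  have hvol : ∀ k : Fin d → ℤ, volume ((fun x : Fin d → ℝ =>
      WithLp.toLp 2 (x + fun i => (k i : ℝ))) ⁻¹' A) = volume A := by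
    intro k
    exact ((PiLp.volume_preserving_toLp (Fin d)).comp
      (measurePreserving_add_right volume fun i => (k i : ℝ))).measure_preimage
        hA.measurableSet.nullMeasurableSet
  simp_rw [hvol]
  rw [Finset.sum_const, hT, Fintype.card_piFinset]
  simp

/-- Shifting a point of the torus by `δ` changes its membership in a ball of radius `ρ` only on the
image of a spherical shell. -/
lemma mem_shell_of_ballIndicator_ne {d : ℕ} {ρ δ : ℝ} (hδ : 0 < δ)
    {u : UnitAddTorus (Fin d)} {e : EuclideanSpace ℝ (Fin d)} (he : ‖e‖ ≤ δ)
    (h : ballIndicator d ρ (u + toTorus e) ≠ ballIndicator d ρ u) :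
    u ∈ toTorus '' {x | ρ - 2 * δ < ‖x‖ ∧ ‖x‖ < ρ + δ} := by
  by_cases h1 : u ∈ torusBall d ρ
  · obtain ⟨v, hv, rfl⟩ := h1
    rw [mem_ball_zero_iff] at hv
    refine ⟨v, ⟨?_, by linarith⟩, rfl⟩
    by_contra hcon
    push Not at hcon
    apply h
    have h2 : toTorus v + toTorus e ∈ torusBall d ρ := by
      refine ⟨v + e, ?_, toTorus_add v e⟩
      rw [mem_ball_zero_iff]
      linarith [norm_add_le v e]
    have h3 : toTorus v ∈ torusBall d ρ := ⟨v, by simpa using hv, rfl⟩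
    rw [ballIndicator, indicator_of_mem h2, indicator_of_mem h3]; rfl
  · by_cases h2 : u + toTorus e ∈ torusBall d ρ
    · obtain ⟨w, hw, hwe⟩ := h2
      rw [mem_ball_zero_iff] at hw
      have hu : toTorus (w - e) = u := by rw [toTorus_sub, hwe, add_sub_cancel_right]
      refine ⟨w - e, ⟨?_, ?_⟩, hu⟩
      · by_contra hcon
        push Not at hcon
        exact h1 ⟨w - e, by rw [mem_ball_zero_iff]; linarith, hu⟩
      · linarith [norm_sub_le w e]
    · exact absurd (by rw [ballIndicator, indicator_of_notMem h1, indicator_of_notMem h2]) h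

lemma volume_shell_le {d : ℕ} {a b : ℝ} (ha : 0 < a) (hab : a < b) :
    volume {x : EuclideanSpace ℝ (Fin d) | a < ‖x‖ ∧ ‖x‖ < b} ≤
      ENNReal.ofReal (unitBallVolume d * (b ^ d - a ^ d)) := by
  have hsub : {x : EuclideanSpace ℝ (Fin d) | a < ‖x‖ ∧ ‖x‖ < b} ⊆
      Metric.ball 0 b \ Metric.ball 0 a := by
    rintro x ⟨h1, h2⟩
    simp only [Set.mem_sdiff, mem_ball_zero_iff]
    exact ⟨h2, not_lt.2 h1.le⟩
  refine (measure_mono hsub).trans ?_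
  rw [← ofReal_measureReal (measure_ne_top_of_subset sdiff_subset measure_ball_lt_top.ne),
    measureReal_sdiff (Metric.ball_subset_ball hab.le) Metric.isOpen_ball.measurableSet,
    volume_real_ball d (ha.trans hab), volume_real_ball d ha]
  exact ENNReal.ofReal_le_ofReal (by linarith)

/-- The error made in the Fourier transform of a ball by rounding to the grid. -/
lemma norm_integral_ballIndicator_gridPoint_sub_le {d M : ℕ} (hM : 0 < M) {ρ δ : ℝ} (hδ : 0 < δ)
    (hδM : d / M ≤ δ) (hδρ : 2 * δ < ρ) (hρ : ρ + δ ≤ 3 / 2) (m : Fin d → ℤ)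
    (p : UnitAddTorus (Fin d)) :
    ‖∫ y, mFourier (-m) y * (ballIndicator d ρ (p - gridPoint M (gridRound M y)) -
        ballIndicator d ρ (p - y)) ∂(torusHaar d)‖ ≤
      3 ^ d * (unitBallVolume d * ((ρ + δ) ^ d - (ρ - 2 * δ) ^ d)) := by
  set A : Set (EuclideanSpace ℝ (Fin d)) := {x | ρ - 2 * δ < ‖x‖ ∧ ‖x‖ < ρ + δ} with hA
  have hAo : IsOpen A := (isOpen_lt continuous_const continuous_norm).inter
    (isOpen_lt continuous_norm continuous_const)
  set S : Set (UnitAddTorus (Fin d)) := (fun y => p - y) ⁻¹' (toTorus '' A) with hS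
  have hSm : MeasurableSet (toTorus '' A) := (isOpenMap_toTorus _ hAo).measurableSet
  have hSm' : MeasurableSet S := (measurable_const.sub measurable_id) hSm
  have hbound : ∀ y, ‖mFourier (-m) y * (ballIndicator d ρ (p - gridPoint M (gridRound M y)) -
        ballIndicator d ρ (p - y))‖ ≤ S.indicator 1 y := by
    intro y
    rw [norm_mul, norm_mFourier_apply, one_mul]
    obtain ⟨e, he, hye⟩ := exists_sub_gridPoint_gridRound hM y
    have e1 : p - gridPoint M (gridRound M y) = p - y + toTorus e := by rw [← hye]; abel
    rw [e1]
    by_cases hne : ballIndicator d ρ (p - y + toTorus e) = ballIndicator d ρ (p - y)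
    · rw [hne, sub_self, norm_zero]
      exact indicator_nonneg (fun _ _ => zero_le_one) _
    · have : y ∈ S := mem_shell_of_ballIndicator_ne hδ (he.trans hδM) hne
      rw [indicator_of_mem this]
      unfold ballIndicator
      by_cases h1 : p - y + toTorus e ∈ torusBall d ρ <;>
        by_cases h2 : p - y ∈ torusBall d ρ <;> simp [h1, h2]
  have hμ : torusHaar d S ≤ ENNReal.ofReal
      (3 ^ d * (unitBallVolume d * ((ρ + δ) ^ d - (ρ - 2 * δ) ^ d))) := by
    have hpres : torusHaar d S = torusHaar d (toTorus '' A) :=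
      (Measure.measurePreserving_sub_left (torusHaar d) p).measure_preimage hSm.nullMeasurableSet
    rw [hpres]
    refine (torusHaar_image_le hAo fun x hx => hx.2.trans_le hρ).trans ?_
    rw [ENNReal.ofReal_mul (by positivity), ENNReal.ofReal_pow (by norm_num)]
    gcongr
    · simp
    · exact volume_shell_le (by linarith) (by linarith)
  refine (norm_integral_le_of_norm_le ((integrable_const (1 : ℝ)).indicator hSm')
    (Eventually.of_forall hbound)).trans ?_
  change ∫ x, S.indicator (1 : UnitAddTorus (Fin d) → ℝ) x ∂(torusHaar d) ≤ _
  rw [integral_indicator_one hSm']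
  refine ENNReal.toReal_le_of_le_ofReal ?_ hμ
  have : (ρ - 2 * δ) ^ d ≤ (ρ + δ) ^ d := pow_le_pow_left₀ (by linarith) (by linarith) d
  have := unitBallVolume_pos d
  exact mul_nonneg (by positivity) (mul_nonneg this.le (by linarith))

/-! ### Exponential sums and the step discrepancy -/

/-- The exponential sum `∑ₙ e(-m · pₙ)`. -/
def expSum {d N : ℕ} (p : Fin N → UnitAddTorus (Fin d)) (m : Fin d → ℤ) : ℂ :=
  ∑ n, mFourier (-m) (p n)

lemma norm_expSum_le {d N : ℕ} (p : Fin N → UnitAddTorus (Fin d)) (m : Fin d → ℤ) :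
    ‖expSum p m‖ ≤ N := by
  refine (norm_sum_le _ _).trans (le_of_eq ?_)
  simp [norm_mFourier_apply]

/-- The frequencies `m` with `|m_i| < X` for all `i`. -/
def freqBox (d X : ℕ) : Finset (Fin d → ℤ) :=
  Fintype.piFinset fun _ => Finset.Ioo (-(X : ℤ)) X

lemma card_freqBox_le (d X : ℕ) : ((freqBox d X).card : ℝ) ≤ (2 * X) ^ d := by
  rw [freqBox, Fintype.card_piFinset]
  simp only [Int.card_Ioo, Finset.prod_const, Finset.card_univ, Fintype.card_fin]
  push_cast
  gcongr
  have : (((X : ℤ) - -(X : ℤ) - 1).toNat : ℝ) ≤ ((2 * X : ℕ) : ℝ) := by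
    exact_mod_cast (by omega : ((X : ℤ) - -(X : ℤ) - 1).toNat ≤ 2 * X)
  simpa using this

/-- The Cassels–Montgomery inequality: expanding the square of a Dirichlet kernel, the diagonal
terms alone contribute `N X^(2d)`. -/
theorem le_sum_sq_norm_expSum {d N : ℕ} (p : Fin N → UnitAddTorus (Fin d)) {X : ℕ} (hX : 0 < X) :
    (N : ℝ) * X ^ d ≤ ∑ m ∈ freqBox d X, ‖expSum p m‖ ^ 2 := by
  set Q : Finset (Fin d → ℤ) := Fintype.piFinset fun _ => Finset.Ico (0 : ℤ) X with hQ
  have hcard : (Q.card : ℝ) = (X : ℝ) ^ d := by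
    rw [hQ, Fintype.card_piFinset]; simp
  have hupper : ∑ a ∈ Q, ∑ b ∈ Q, ‖expSum p (a - b)‖ ^ 2 ≤
      (X : ℝ) ^ d * ∑ m ∈ freqBox d X, ‖expSum p m‖ ^ 2 := by
    rw [← hcard, ← nsmul_eq_mul, ← Finset.sum_const]
    refine Finset.sum_le_sum fun a ha => ?_
    have hinj : InjOn (fun b : Fin d → ℤ => a - b) Q := fun b _ b' _ h => sub_right_injective h
    rw [← Finset.sum_image (f := fun m => ‖expSum p m‖ ^ 2) hinj]
    refine Finset.sum_le_sum_of_subset_of_nonneg ?_ fun _ _ _ => sq_nonneg _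
    intro m hm
    obtain ⟨b, hb, rfl⟩ := Finset.mem_image.1 hm
    rw [hQ, Fintype.mem_piFinset] at ha hb
    rw [freqBox, Fintype.mem_piFinset]
    intro i
    have h1 := Finset.mem_Ico.1 (ha i)
    have h2 := Finset.mem_Ico.1 (hb i)
    rw [Finset.mem_Ioo, Pi.sub_apply]
    omega
  have hexpand : ∑ a ∈ Q, ∑ b ∈ Q, ‖expSum p (a - b)‖ ^ 2 =
      ∑ n, ∑ n', ‖∑ a ∈ Q, mFourier (-a) (p n) * mFourier a (p n')‖ ^ 2 := by
    have hc : ∀ z : ℂ, ((‖z‖ ^ 2 : ℝ) : ℂ) = z * (starRingEnd ℂ) z := fun z => by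
      rw [Complex.mul_conj, Complex.normSq_eq_norm_sq]
    apply Complex.ofReal_injective
    push_cast
    simp_rw [← Complex.ofReal_pow, hc, expSum, map_sum, map_mul, Finset.sum_mul_sum,
      ← mFourier_neg, neg_neg]
    have hterm : ∀ (a b : Fin d → ℤ) (x y : UnitAddTorus (Fin d)),
        mFourier (-(a - b)) x * mFourier (a - b) y =
          mFourier (-a) x * mFourier a y * (mFourier b x * mFourier (-b) y) := by
      intro a b x y
      rw [neg_sub, sub_eq_add_neg, sub_eq_add_neg, mFourier_add, mFourier_add]
      ring
    simp_rw [hterm]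
    calc _ = ∑ a ∈ Q, ∑ n, ∑ b ∈ Q, ∑ n', mFourier (-a) (p n) * mFourier a (p n') *
          (mFourier b (p n) * mFourier (-b) (p n')) :=
          Finset.sum_congr rfl fun a _ => Finset.sum_comm
      _ = ∑ n, ∑ a ∈ Q, ∑ b ∈ Q, ∑ n', mFourier (-a) (p n) * mFourier a (p n') *
          (mFourier b (p n) * mFourier (-b) (p n')) := Finset.sum_comm
      _ = ∑ n, ∑ a ∈ Q, ∑ n', ∑ b ∈ Q, mFourier (-a) (p n) * mFourier a (p n') *
          (mFourier b (p n) * mFourier (-b) (p n')) :=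
          Finset.sum_congr rfl fun n _ => Finset.sum_congr rfl fun a _ => Finset.sum_comm
      _ = _ := Finset.sum_congr rfl fun n _ => Finset.sum_comm
  have hlower : (N : ℝ) * ((X : ℝ) ^ d) ^ 2 ≤
      ∑ n, ∑ n', ‖∑ a ∈ Q, mFourier (-a) (p n) * mFourier a (p n')‖ ^ 2 := by
    calc (N : ℝ) * ((X : ℝ) ^ d) ^ 2 = ∑ _n : Fin N, ((X : ℝ) ^ d) ^ 2 := by simp
      _ ≤ _ := by
        refine Finset.sum_le_sum fun n _ => ?_
        refine le_trans (le_of_eq ?_) (Finset.single_le_sum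
          (f := fun n' => ‖∑ a ∈ Q, mFourier (-a) (p n) * mFourier a (p n')‖ ^ 2)
          (fun _ _ => sq_nonneg _) (Finset.mem_univ n))
        have h1 : ∀ a : Fin d → ℤ, mFourier (-a) (p n) * mFourier a (p n) = 1 := by
          intro a
          rw [← mFourier_add, neg_add_cancel, mFourier_zero]; rfl
        simp_rw [h1]
        rw [Finset.sum_const, nsmul_eq_mul, mul_one, Complex.norm_natCast, hcard]
  have hXd : 0 < (X : ℝ) ^ d := by positivity
  have h := hlower.trans (hexpand.symm.le.trans hupper)
  refine le_of_mul_le_mul_left ?_ hXd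
  calc (X : ℝ) ^ d * (N * X ^ d) = N * ((X : ℝ) ^ d) ^ 2 := by ring
    _ ≤ _ := h

lemma norm_frequency_le {d X : ℕ} {m : Fin d → ℤ} (hm : m ∈ freqBox d X) :
    ‖frequency m‖ ≤ 2 * Real.pi * d * X := by
  have h1 : ‖frequency m‖ ^ 2 ≤ (2 * Real.pi * d * X) ^ 2 := by
    rw [EuclideanSpace.norm_sq_eq]
    calc ∑ i, ‖frequency m i‖ ^ 2 ≤ ∑ _i : Fin d, (2 * Real.pi * X) ^ 2 := by
          refine Finset.sum_le_sum fun i _ => ?_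
          have h := Finset.mem_Ioo.1 ((Fintype.mem_piFinset.1 hm) i)
          have h2 : |(m i : ℝ)| ≤ X := by
            rw [abs_le]
            exact ⟨by exact_mod_cast h.1.le, by exact_mod_cast h.2.le⟩
          have : ‖frequency m i‖ = 2 * Real.pi * |(m i : ℝ)| := by
            simp [frequency, abs_of_pos Real.pi_pos]
          rw [this]
          have := Real.pi_pos
          gcongr
      _ = d * (2 * Real.pi * X) ^ 2 := by simp
      _ ≤ (d : ℝ) ^ 2 * (2 * Real.pi * X) ^ 2 := by
          gcongr; exact_mod_cast Nat.le_self_pow two_ne_zero d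
      _ = _ := by ring
  have := Real.pi_pos
  exact le_of_sq_le_sq h1 (by positivity)

lemma abs_le_norm_frequency {d : ℕ} (m : Fin d → ℤ) (i : Fin d) :
    |(m i : ℝ)| ≤ ‖frequency m‖ := by
  refine le_trans ?_ (PiLp.norm_apply_le (frequency m) i)
  have : ‖frequency m i‖ = 2 * Real.pi * |(m i : ℝ)| := by
    simp [frequency, abs_of_pos Real.pi_pos]
  rw [this]
  nlinarith [abs_nonneg (m i : ℝ), Real.pi_gt_three]

lemma card_filter_norm_frequency_lt_le {d : ℕ} (s : Finset (Fin d → ℤ)) {R : ℝ} (hR : 0 ≤ R) :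
    ((s.filter fun m => ‖frequency m‖ < R).card : ℝ) ≤ (2 * R + 1) ^ d := by
  have hsub : (s.filter fun m => ‖frequency m‖ < R) ⊆
      Fintype.piFinset fun _ : Fin d => Finset.Icc (-⌊R⌋) ⌊R⌋ := by
    intro m hm
    rw [Fintype.mem_piFinset]
    intro i
    have h := abs_le.1 ((abs_le_norm_frequency m i).trans (Finset.mem_filter.1 hm).2.le)
    rw [Finset.mem_Icc]
    refine ⟨?_, Int.le_floor.2 h.2⟩
    have : -(m i) ≤ ⌊R⌋ := Int.le_floor.2 (by push_cast; linarith [h.1])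
    omega
  have h1 : ((s.filter fun m => ‖frequency m‖ < R).card : ℝ) ≤ _ :=
    Nat.cast_le.2 (Finset.card_le_card hsub)
  refine h1.trans ?_
  rw [Fintype.card_piFinset]
  simp only [Int.card_Icc, Finset.prod_const, Finset.card_univ, Fintype.card_fin]
  push_cast
  gcongr
  have h0 : 0 ≤ ⌊R⌋ := Int.floor_nonneg.2 hR
  have h2 : (((⌊R⌋ + 1 - -⌊R⌋).toNat : ℤ) : ℝ) = 2 * (⌊R⌋ : ℝ) + 1 := by
    rw [Int.toNat_of_nonneg (by omega)]; push_cast; ring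
  rw [Int.cast_natCast] at h2
  rw [h2]
  linarith [Int.floor_le R]

/-- The exponential sums have large mean square over the frequencies of size at least `R`, as soon
as the box of frequencies is large compared with `R` and the number of points. -/
lemma le_sum_filter_sq_norm_expSum {d N : ℕ} (p : Fin N → UnitAddTorus (Fin d)) {X : ℕ}
    (hX : 0 < X) {R : ℝ} (hR : 0 ≤ R) (hXR : 2 * N * (2 * R + 1) ^ d ≤ (X : ℝ) ^ d) :
    (N : ℝ) * X ^ d / 2 ≤
      ∑ m ∈ (freqBox d X).filter (fun m => R ≤ ‖frequency m‖), ‖expSum p m‖ ^ 2 := by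
  have h := le_sum_sq_norm_expSum p hX
  rw [← Finset.sum_filter_add_sum_filter_not _ (fun m => R ≤ ‖frequency m‖)] at h
  have h2 : ∑ m ∈ (freqBox d X).filter (fun m => ¬ R ≤ ‖frequency m‖), ‖expSum p m‖ ^ 2 ≤
      (2 * R + 1) ^ d * (N : ℝ) ^ 2 := by
    simp_rw [not_le]
    calc _ ≤ ∑ _m ∈ (freqBox d X).filter (fun m => ‖frequency m‖ < R), (N : ℝ) ^ 2 := by
          refine Finset.sum_le_sum fun m _ => ?_
          exact pow_le_pow_left₀ (norm_nonneg _) (norm_expSum_le p m) 2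
      _ ≤ _ := by
          rw [Finset.sum_const, nsmul_eq_mul]
          gcongr
          exact card_filter_norm_frequency_lt_le _ hR
  have h3 := mul_le_mul_of_nonneg_left hXR (Nat.cast_nonneg (α := ℝ) N)
  nlinarith

/-- The discrepancy of the translate of a ball to the corner of the cell of `y`. -/
def stepDiscrepancy {d N : ℕ} (M : ℕ) (ρ : ℝ) (p : Fin N → UnitAddTorus (Fin d))
    (y : UnitAddTorus (Fin d)) : ℝ :=
  discrepancy (torusTranslate (gridPoint M (gridRound M y)) (torusBall d ρ)) p

lemma mem_torusTranslate_iff {d : ℕ} {x y : UnitAddTorus (Fin d)}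
    {A : Set (UnitAddTorus (Fin d))} : y ∈ torusTranslate x A ↔ y - x ∈ A := by
  constructor
  · rintro ⟨z, hz, rfl⟩
    simpa using hz
  · intro h
    exact ⟨y - x, h, by simp⟩

/-- The volume term of the discrepancy is a constant `v`; its value plays no role, as only nonzero
frequencies are used. -/
lemma exists_stepDiscrepancy_eq {d : ℕ} (ρ : ℝ) : ∃ v : ℝ, ∀ (N M : ℕ)
    (p : Fin N → UnitAddTorus (Fin d)) (y : UnitAddTorus (Fin d)),
    (stepDiscrepancy M ρ p y : ℂ) =
      ∑ n, ballIndicator d ρ (p n - gridPoint M (gridRound M y)) - N * v := by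
  refine ⟨(volume (torusBall d ρ)).toReal, fun N M p y => ?_⟩
  have hv : volume (torusTranslate (gridPoint M (gridRound M y)) (torusBall d ρ)) =
      volume (torusBall d ρ) := by
    rw [torusTranslate, image_add_left, measure_preimage_add]
  rw [stepDiscrepancy, discrepancy, hv]
  push_cast
  congr 1
  refine Finset.sum_congr rfl fun n _ => ?_
  unfold ballIndicator
  by_cases h : p n - gridPoint M (gridRound M y) ∈ torusBall d ρ
  · rw [indicator_of_mem h, indicator_of_mem (mem_torusTranslate_iff.2 h)]; simp
  · rw [indicator_of_notMem h, indicator_of_notMem (fun h' => h (mem_torusTranslate_iff.1 h'))]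
    simp

lemma measurable_gridPoint_gridRound {d : ℕ} (M : ℕ) :
    Measurable fun y : UnitAddTorus (Fin d) => gridPoint M (gridRound M y) :=
  (measurable_of_countable (gridPoint M)).comp (measurable_gridRound M)

lemma integrable_mFourier_mul {d : ℕ} (m : Fin d → ℤ) {f : UnitAddTorus (Fin d) → ℂ}
    (hf : Measurable f) {K : ℝ} (hK : ∀ y, ‖f y‖ ≤ K) :
    Integrable (fun y => mFourier m y * f y) (torusHaar d) := by
  refine (integrable_const K).mono'
    ((continuous_mFourier m).measurable.mul hf).aestronglyMeasurable
    (Eventually.of_forall fun y => ?_)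
  rw [norm_mul, norm_mFourier_apply, one_mul]
  exact hK y

/-- The Fourier coefficients of the step discrepancy: up to rounding errors, they are those of the
continuous discrepancy. -/
lemma norm_integral_stepDiscrepancy_sub_le {d M N : ℕ} (hM : 0 < M) {ρ δ : ℝ} (hδ : 0 < δ)
    (hδM : d / M ≤ δ) (hδρ : 2 * δ < ρ) (hρ : ρ + δ ≤ 3 / 2) {m : Fin d → ℤ} (hm : m ≠ 0)
    (p : Fin N → UnitAddTorus (Fin d)) :
    ‖∫ y, mFourier (-m) y * stepDiscrepancy M ρ p y ∂(torusHaar d) -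
        ballCoeff d ρ m * expSum p m‖ ≤
      N * (3 ^ d * (unitBallVolume d * ((ρ + δ) ^ d - (ρ - 2 * δ) ^ d))) := by
  obtain ⟨v, hv⟩ := exists_stepDiscrepancy_eq (d := d) ρ
  have hi1 : ∀ n, Integrable (fun y => mFourier (-m) y *
      ballIndicator d ρ (p n - gridPoint M (gridRound M y))) (torusHaar d) := fun n =>
    integrable_mFourier_mul _ ((measurable_ballIndicator d ρ).comp
      (measurable_const.sub (measurable_gridPoint_gridRound M)))
      fun y => norm_ballIndicator_le d ρ _
  have hi2 : ∀ n, Integrable (fun y => mFourier (-m) y * ballIndicator d ρ (p n - y))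
      (torusHaar d) := fun n =>
    integrable_mFourier_mul _ ((measurable_ballIndicator d ρ).comp
      (measurable_const.sub measurable_id)) fun y => norm_ballIndicator_le d ρ _
  have hi3 : Integrable (fun y => mFourier (-m) y * ((N : ℂ) * v)) (torusHaar d) :=
    integrable_mFourier_mul _ measurable_const (fun _ => le_rfl)
  have h1 : ∫ y, mFourier (-m) y * stepDiscrepancy M ρ p y ∂(torusHaar d) =
      ∑ n, ∫ y, mFourier (-m) y *
        ballIndicator d ρ (p n - gridPoint M (gridRound M y)) ∂(torusHaar d) := by
    simp_rw [hv, mul_sub, Finset.mul_sum]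
    rw [integral_sub (integrable_finsetSum _ fun n _ => hi1 n) hi3,
      integral_finsetSum _ fun n _ => hi1 n, integral_mul_const,
      integral_mFourier_eq_zero (neg_ne_zero.2 hm), zero_mul, sub_zero]
  have h2 : ballCoeff d ρ m * expSum p m =
      ∑ n, ∫ y, mFourier (-m) y * ballIndicator d ρ (p n - y) ∂(torusHaar d) := by
    simp_rw [integral_mFourier_mul_ballIndicator_sub]
    rw [expSum, ← Finset.sum_mul, mul_comm]
  rw [h1, h2, ← Finset.sum_sub_distrib]
  refine (norm_sum_le _ _).trans ?_
  calc _ ≤ ∑ _n : Fin N, 3 ^ d * (unitBallVolume d * ((ρ + δ) ^ d - (ρ - 2 * δ) ^ d)) := by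
        refine Finset.sum_le_sum fun n _ => ?_
        rw [← integral_sub (hi1 n) (hi2 n)]
        simp_rw [← mul_sub]
        exact norm_integral_ballIndicator_gridPoint_sub_le hM hδ hδM hδρ hρ m (p n)
    _ = _ := by simp

lemma memLp_stepDiscrepancy {d N : ℕ} (M : ℕ) (ρ : ℝ) (p : Fin N → UnitAddTorus (Fin d)) :
    MemLp (fun y => (stepDiscrepancy M ρ p y : ℂ)) 2 (torusHaar d) := by
  obtain ⟨v, hv⟩ := exists_stepDiscrepancy_eq (d := d) ρ
  simp_rw [hv]
  have hmeas : Measurable fun y : UnitAddTorus (Fin d) =>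
      ∑ n, ballIndicator d ρ (p n - gridPoint M (gridRound M y)) - N * (v : ℂ) :=
    (Finset.measurable_fun_sum _ fun n _ => (measurable_ballIndicator d ρ).comp
      (measurable_const.sub (measurable_gridPoint_gridRound M))).sub_const _
  refine MemLp.of_bound hmeas.aestronglyMeasurable (N + ‖N * (v : ℂ)‖)
    (Eventually.of_forall fun y => ?_)
  refine (norm_sub_le _ _).trans ?_
  gcongr
  refine (norm_sum_le_of_le _ fun n _ => norm_ballIndicator_le d ρ _).trans ?_
  simp

/-- The mean square of the discrepancy over the grid dominates the contribution of finitely many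
Fourier modes of the continuous discrepancy, minus the rounding errors. -/
lemma sum_ballCoeff_sq_mul_le {d M N : ℕ} (hM : 0 < M) (hMe : Even M) {ρ δ : ℝ} (hδ : 0 < δ)
    (hδM : d / M ≤ δ) (hδρ : 2 * δ < ρ) (hρ : ρ + δ ≤ 3 / 2) {s : Finset (Fin d → ℤ)}
    (hs : ∀ m ∈ s, m ≠ 0) (p : Fin N → UnitAddTorus (Fin d)) :
    (∑ m ∈ s, ‖ballCoeff d ρ m‖ ^ 2 * ‖expSum p m‖ ^ 2) / 2 -
        s.card * (N * (3 ^ d * (unitBallVolume d * ((ρ + δ) ^ d - (ρ - 2 * δ) ^ d)))) ^ 2 ≤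
      1 / (M : ℝ) ^ d * ∑ j ∈ Fintype.piFinset (fun _ : Fin d => gridIndices M),
        |discrepancy (torusTranslate (gridPoint M j) (torusBall d ρ)) p| ^ 2 := by
  set ε := N * (3 ^ d * (unitBallVolume d * ((ρ + δ) ^ d - (ρ - 2 * δ) ^ d)))
  rw [← integral_gridRound hM hMe fun j =>
    |discrepancy (torusTranslate (gridPoint M j) (torusBall d ρ)) p| ^ 2]
  have hB := sum_sq_norm_integral_mFourier_mul_le (memLp_stepDiscrepancy M ρ p) s
  have he : ∀ y, ‖(stepDiscrepancy M ρ p y : ℂ)‖ ^ 2 = |discrepancy (torusTranslate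
      (gridPoint M (gridRound M y)) (torusBall d ρ)) p| ^ 2 := fun y => by
    rw [Complex.norm_real]; rfl
  simp_rw [he] at hB
  refine le_trans ?_ hB
  rw [Finset.sum_div, ← nsmul_eq_mul, ← Finset.sum_const, ← Finset.sum_sub_distrib]
  refine Finset.sum_le_sum fun m hm => ?_
  have h := norm_integral_stepDiscrepancy_sub_le hM hδ hδM hδρ hρ (hs m hm) p
  set a := ∫ y, mFourier (-m) y * stepDiscrepancy M ρ p y ∂(torusHaar d)
  set b := ballCoeff d ρ m * expSum p m with hb
  have h1 : ‖b‖ ≤ ‖a‖ + ε := by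
    have := norm_sub_norm_le b a
    rw [norm_sub_rev] at this
    linarith
  rw [← mul_pow, ← norm_mul, ← hb]
  have h2 := pow_le_pow_left₀ (norm_nonneg b) h1 2
  nlinarith [sq_nonneg (‖a‖ - ε)]

/-! ### The lower bound -/

lemma sin_pi_mul_div_four_ne_zero {n : ℕ} (hn : ¬ 4 ∣ n) :
    Real.sin (Real.pi * ((n : ℝ) / 2) / 2) ≠ 0 := by
  intro h
  obtain ⟨k, hk⟩ := Real.sin_eq_zero_iff.1 h
  apply hn
  have h1 : (n : ℝ) = ((4 * k : ℤ) : ℝ) := by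
    have : Real.pi * (k - n / 4) = 0 := by linarith
    rcases mul_eq_zero.1 this with h | h
    · exact absurd h Real.pi_ne_zero
    · push_cast; linarith
  have h2 : (n : ℤ) = 4 * k := by exact_mod_cast h1
  exact_mod_cast Dvd.intro k h2.symm

/-- One of the balls of radius `r` and `2r` has a Fourier coefficient of the expected size at every
frequency that is large compared with `1/r`. -/
lemma exists_le_ballCoeff_sq {n : ℕ} (hn : ¬ 4 ∣ n) :
    ∃ t₀ c : ℝ, 0 < t₀ ∧ 0 < c ∧ ∀ r : ℝ, 0 < r → r < 1 / 4 → ∀ m : Fin (n + 1) → ℤ,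
      t₀ / r ≤ ‖frequency m‖ → c * r ^ n ≤ ‖frequency m‖ ^ (n + 2) *
        (‖ballCoeff (n + 1) r m‖ ^ 2 + ‖ballCoeff (n + 1) (2 * r) m‖ ^ 2) := by
  have hn0 : 0 < n := Nat.pos_of_ne_zero fun h => hn (h ▸ dvd_zero 4)
  have hα : 0 < (n : ℝ) / 2 := by positivity
  obtain ⟨t₀, c, ht₀, hc, H⟩ := exists_le_oscIntegral_sq hα (sin_pi_mul_div_four_ne_zero hn)
  set V := unitBallVolume n
  have hV : 0 < V := unitBallVolume_pos n
  refine ⟨t₀, c * V ^ 2, ht₀, by positivity, fun r hr hr4 m hm => ?_⟩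
  set f := ‖frequency m‖
  have hf : 0 < f := lt_of_lt_of_le (by positivity) hm
  have ht : t₀ ≤ r * f := by rw [div_le_iff₀ hr] at hm; linarith
  have h := H (r * f) ht
  have hpow : ∀ t : ℝ, 0 < t → (t ^ ((n : ℝ) / 2 + 1)) ^ 2 = t ^ (n + 2) := by
    intro t ht
    rw [← Real.rpow_natCast, ← Real.rpow_mul ht.le, ← Real.rpow_natCast]
    congr 1; push_cast; ring
  rw [mul_pow, mul_pow, hpow _ (by positivity), hpow _ (by positivity)] at h
  rw [ballCoeff_eq hr (by linarith), ballCoeff_eq (by linarith) (by linarith), mul_assoc 2 r f,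
    show unitBallVolume n = V from rfl]
  simp only [norm_mul, norm_pow, Complex.norm_real, Real.norm_eq_abs, abs_of_pos hr, abs_of_pos hV,
    Complex.ofReal_mul, Complex.ofReal_ofNat, Complex.norm_ofNat]
  set O₁ := ‖oscIntegral (n / 2) (r * f)‖
  set O₂ := ‖oscIntegral (n / 2) (2 * (r * f))‖
  have h2 : (2 : ℝ) ^ (n + 2) ≤ 2 ^ (2 * n + 2) := pow_le_pow_right₀ (by norm_num) (by omega)
  have hrn : 0 < r ^ n := by positivity
  calc c * V ^ 2 * r ^ n
      ≤ ((r * f) ^ (n + 2) * O₁ ^ 2 + (2 * (r * f)) ^ (n + 2) * O₂ ^ 2) * V ^ 2 * r ^ n := by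
        gcongr
    _ = f ^ (n + 2) * (r ^ (2 * n + 2) * V ^ 2 * O₁ ^ 2 +
          2 ^ (n + 2) * (r ^ (2 * n + 2) * V ^ 2 * O₂ ^ 2)) := by ring
    _ ≤ f ^ (n + 2) * (r ^ (2 * n + 2) * V ^ 2 * O₁ ^ 2 +
          2 ^ (2 * n + 2) * (r ^ (2 * n + 2) * V ^ 2 * O₂ ^ 2)) := by gcongr
    _ = _ := by ring

lemma pow_succ_sub_pow_succ_le (n : ℕ) {a b : ℝ} (hb : 0 ≤ b) (hab : b ≤ a) :
    a ^ (n + 1) - b ^ (n + 1) ≤ (n + 1) * (a - b) * a ^ n := by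
  have ha : 0 ≤ a := hb.trans hab
  induction n with
  | zero => simp
  | succ n ih =>
    have h1 : b ^ (n + 1) ≤ a ^ (n + 1) := pow_le_pow_left₀ hb hab _
    have h2 := mul_le_mul_of_nonneg_left ih ha
    have h3 := mul_le_mul_of_nonneg_left h1 (sub_nonneg.2 hab)
    push_cast
    calc a ^ (n + 1 + 1) - b ^ (n + 1 + 1)
        = a * (a ^ (n + 1) - b ^ (n + 1)) + (a - b) * b ^ (n + 1) := by ring
      _ ≤ a * ((n + 1) * (a - b) * a ^ n) + (a - b) * a ^ (n + 1) := by linarith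
      _ = _ := by ring

lemma card_gridIndices {M : ℕ} (hM : Even M) : (gridIndices M).card = M := by
  obtain ⟨K, rfl⟩ := hM
  have e1 : -((K + K : ℕ) : ℝ) / 2 = ((-(K : ℤ) : ℤ) : ℝ) := by push_cast; ring
  have e2 : ((K + K : ℕ) : ℝ) / 2 = ((K : ℤ) : ℝ) := by push_cast; ring
  rw [gridIndices, e1, e2, Int.ceil_intCast, Int.ceil_intCast, Int.card_Ico]
  omega

/-- The rounding error at radius between `r` and `2r`, for shells of thickness `3δ`. -/
lemma shell_bound {n : ℕ} {r ρ δ : ℝ} (hδ : 0 < δ) (hδr : δ ≤ r / 4) (hρ1 : r ≤ ρ)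
    (hρ2 : ρ ≤ 2 * r) :
    (ρ + δ) ^ (n + 1) - (ρ - 2 * δ) ^ (n + 1) ≤ (n + 1) * (3 * δ) * (3 * r) ^ n := by
  refine (pow_succ_sub_pow_succ_le n (by linarith) (by linarith)).trans ?_
  have : ρ + δ - (ρ - 2 * δ) = 3 * δ := by ring
  rw [this]
  gcongr
  · linarith
  · linarith

/-- The mean square discrepancy for the two radii, before the choice of the frequency cut-off `X`:
`c`, `t₀` are constants for the Fourier coefficients of balls. -/
lemma le_grid_mean_of_cutoff {n : ℕ} {t₀ c : ℝ} (ht₀ : 0 < t₀)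
    (hcoeff : ∀ r : ℝ, 0 < r → r < 1 / 4 → ∀ m : Fin (n + 1) → ℤ,
      t₀ / r ≤ ‖frequency m‖ → c * r ^ n ≤ ‖frequency m‖ ^ (n + 2) *
        (‖ballCoeff (n + 1) r m‖ ^ 2 + ‖ballCoeff (n + 1) (2 * r) m‖ ^ 2))
    {r : ℝ} (hr : 0 < r) (hr4 : r < 1 / 4) {M N X : ℕ} (hM : 0 < M) (hMe : Even M)
    (hMr : ((n + 1 : ℕ) : ℝ) / M ≤ r / 4) (hX : 0 < X)
    (hXR : 2 * N * (2 * (t₀ / r) + 1) ^ (n + 1) ≤ (X : ℝ) ^ (n + 1))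
    (p : Fin N → UnitAddTorus (Fin (n + 1))) :
    c * r ^ n / (2 * Real.pi * (n + 1 : ℕ) * X) ^ (n + 2) * (N * X ^ (n + 1) / 2) / 2 -
        2 * ((2 * X) ^ (n + 1) * (N * (3 ^ (n + 1) * (unitBallVolume (n + 1) *
          ((n + 1) * (3 * (((n + 1 : ℕ) : ℝ) / M)) * (3 * r) ^ n)))) ^ 2) ≤
      1 / ((gridIndices M).card : ℝ) ^ (n + 1) * ∑ k ∈ ({1, 2} : Finset ℕ),
        ∑ j ∈ Fintype.piFinset (fun _ : Fin (n + 1) => gridIndices M),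
          |discrepancy (torusTranslate (gridPoint M j) (torusBall (n + 1) ((k : ℝ) * r))) p|
            ^ 2 := by
  have hM' : (0 : ℝ) < M := by exact_mod_cast hM
  have hX' : (0 : ℝ) < X := by exact_mod_cast hX
  set δ : ℝ := ((n + 1 : ℕ) : ℝ) / M with hδdef
  have hδ : 0 < δ := by positivity
  set Λ := (freqBox (n + 1) X).filter fun m => t₀ / r ≤ ‖frequency m‖ with hΛ
  have hΛ0 : ∀ m ∈ Λ, m ≠ 0 := by
    rintro m hm rfl
    have h := (Finset.mem_filter.1 hm).2
    have h0 : ‖frequency (0 : Fin (n + 1) → ℤ)‖ = 0 := by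
      rw [norm_eq_zero]; ext i; simp [frequency]
    have : 0 < t₀ / r := by positivity
    linarith
  have hcard : (Λ.card : ℝ) ≤ (2 * X) ^ (n + 1) :=
    (Nat.cast_le.2 (Finset.card_filter_le _ _)).trans (card_freqBox_le (n + 1) X)
  set E := N * (3 ^ (n + 1) * (unitBallVolume (n + 1) *
    ((n + 1) * (3 * δ) * (3 * r) ^ n))) with hE
  have hVpos := unitBallVolume_pos (n + 1)
  have hone : ∀ ρ : ℝ, r ≤ ρ → ρ ≤ 2 * r →
      (∑ m ∈ Λ, ‖ballCoeff (n + 1) ρ m‖ ^ 2 * ‖expSum p m‖ ^ 2) / 2 - (2 * X) ^ (n + 1) * E ^ 2 ≤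
      1 / (M : ℝ) ^ (n + 1) * ∑ j ∈ Fintype.piFinset (fun _ : Fin (n + 1) => gridIndices M),
        |discrepancy (torusTranslate (gridPoint M j) (torusBall (n + 1) ρ)) p| ^ 2 := by
    intro ρ h1 h2
    refine le_trans ?_ (sum_ballCoeff_sq_mul_le hM hMe hδ le_rfl (by linarith) (by linarith) hΛ0 p)
    have hs := shell_bound (n := n) hδ hMr h1 h2
    have hs0 : 0 ≤ (ρ + δ) ^ (n + 1) - (ρ - 2 * δ) ^ (n + 1) :=
      sub_nonneg.2 (pow_le_pow_left₀ (by linarith) (by linarith) _)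
    rw [hE]
    gcongr
  have h1 := hone r le_rfl (by linarith)
  have h2 := hone (2 * r) (by linarith) le_rfl
  have hsum : c * r ^ n / (2 * Real.pi * (n + 1 : ℕ) * X) ^ (n + 2) * (N * X ^ (n + 1) / 2) ≤
      ∑ m ∈ Λ, ‖ballCoeff (n + 1) r m‖ ^ 2 * ‖expSum p m‖ ^ 2 +
      ∑ m ∈ Λ, ‖ballCoeff (n + 1) (2 * r) m‖ ^ 2 * ‖expSum p m‖ ^ 2 := by
    have hS := le_sum_filter_sq_norm_expSum p hX (by positivity) hXR
    rw [← Finset.sum_add_distrib]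
    have hpt : ∀ m ∈ Λ, c * r ^ n / (2 * Real.pi * (n + 1 : ℕ) * X) ^ (n + 2) ≤
        ‖ballCoeff (n + 1) r m‖ ^ 2 + ‖ballCoeff (n + 1) (2 * r) m‖ ^ 2 := by
      intro m hm
      have hm' := Finset.mem_filter.1 hm
      have hf := norm_frequency_le hm'.1
      have hp := Real.pi_pos
      rw [div_le_iff₀ (by positivity), mul_comm (_ + _)]
      refine (hcoeff r hr hr4 m hm'.2).trans ?_
      gcongr
    by_cases hc : 0 ≤ c * r ^ n / (2 * Real.pi * (n + 1 : ℕ) * X) ^ (n + 2)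
    · calc _ ≤ c * r ^ n / (2 * Real.pi * (n + 1 : ℕ) * X) ^ (n + 2) *
            ∑ m ∈ Λ, ‖expSum p m‖ ^ 2 := by gcongr
        _ ≤ _ := by
          rw [Finset.mul_sum]
          refine Finset.sum_le_sum fun m hm => ?_
          rw [← add_mul]
          exact mul_le_mul_of_nonneg_right (hpt m hm) (sq_nonneg _)
    · -- The bound is trivial for negative `c`.
      push Not at hc
      refine (mul_nonpos_of_nonpos_of_nonneg hc.le (by positivity)).trans ?_
      exact Finset.sum_nonneg fun m _ => by positivity
  rw [card_gridIndices hMe, Finset.sum_pair (by norm_num), mul_add]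
  simp only [Nat.cast_one, one_mul, Nat.cast_ofNat]
  linarith

/-- The main term at a cut-off `X` comparable with `A / r`. -/
lemma le_cutoff_main_term (n : ℕ) {c P K A X r N : ℝ} (hc : 0 < c) (hP : 0 < P) (hK : 0 < K)
    (hA : 0 < A) (hX : 0 < X) (hr : 0 < r) (hN : 0 < N) (hXup : X ≤ 2 * K * A / r) :
    c / (8 * P ^ (n + 2) * K) * (r ^ (n + 1) * N / A) ≤
      c * r ^ n / (P * X) ^ (n + 2) * (N * X ^ (n + 1) / 2) / 2 := by
  have e : c * r ^ n / (P * X) ^ (n + 2) * (N * X ^ (n + 1) / 2) / 2 =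
      c * r ^ n * N / (4 * P ^ (n + 2)) * (1 / X) := by
    rw [mul_pow, pow_succ X (n + 1)]
    field_simp
    ring
  have hinv : r / (2 * K * A) ≤ 1 / X := by
    rw [div_le_div_iff₀ (by positivity) hX, one_mul]
    calc r * X ≤ r * (2 * K * A / r) := by gcongr
      _ = _ := by field_simp
  rw [e]
  calc c / (8 * P ^ (n + 2) * K) * (r ^ (n + 1) * N / A)
      = c * r ^ n * N / (4 * P ^ (n + 2)) * (r / (2 * K * A)) := by
        rw [pow_succ]; field_simp; ring
    _ ≤ _ := by gcongr

/-- The rounding errors at a cut-off `X` comparable with `A / r`, for a grid of step `u`; with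
`A = N^(1/d)` and `G = N^(1+1/(2d))` they are a small multiple of the main term. -/
lemma cutoff_error_term_le (n : ℕ) {c K L A X r N C G u : ℝ} (hc : 0 < c) (hK : 0 < K)
    (hL : 0 < L) (hA : 0 < A) (hX : 0 < X) (hr : 0 < r) (hN : 0 < N) (hC : 0 < C)
    (hu : 0 ≤ u) (hXup : X ≤ 2 * K * A / r) (hAN : A ^ (n + 1) = N) (hGsq : G ^ 2 = N ^ 2 * A)
    (huC : u ≤ r / (C * G)) (hCc : 2 * (2 * (4 * K) ^ (n + 1) * L ^ 2) / c ≤ C ^ 2) :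
    2 * ((2 * X) ^ (n + 1) * (L * N * r ^ n * u) ^ 2) ≤ c / 2 * (r ^ (n + 1) * N / A) := by
  have e2 : (r / (C * G)) ^ 2 = r ^ 2 / (C ^ 2 * (N ^ 2 * A)) := by
    rw [div_pow, mul_pow, hGsq]
  have e3 : (2 * (2 * K * A / r)) ^ (n + 1) = (4 * K) ^ (n + 1) * N / r ^ (n + 1) := by
    rw [← hAN, ← mul_pow, ← div_pow]; congr 1; ring
  calc 2 * ((2 * X) ^ (n + 1) * (L * N * r ^ n * u) ^ 2)
      ≤ 2 * ((2 * (2 * K * A / r)) ^ (n + 1) * (L * N * r ^ n * (r / (C * G))) ^ 2) := by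
        gcongr
    _ = (2 * (4 * K) ^ (n + 1) * L ^ 2) / C ^ 2 * (r ^ (n + 1) * N / A) := by
        rw [mul_pow (L * N * r ^ n), e2, e3]
        generalize (4 * K) ^ (n + 1) = Q
        rw [pow_succ]
        field_simp
    _ ≤ c / 2 * (r ^ (n + 1) * N / A) := by
        refine mul_le_mul_of_nonneg_right ?_ (by positivity)
        rw [div_le_iff₀ hc] at hCc
        rw [div_le_div_iff₀ (by positivity) (by norm_num)]
        linarith

theorem theorem3 (d : ℕ) (hd0 : 0 < d) (hd : ¬ d ≡ 1 [MOD 4]) :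
    ∃ C c : ℝ, 0 < C ∧ 0 < c ∧
      ∀ r : ℝ, 0 < r → r < 1 / 4 →
      ∀ N : ℕ, 0 < N →
      ∀ M : ℕ, Even M →
        C * (N : ℝ) ^ (1 + 1 / (2 * (d : ℝ))) * r⁻¹ ≤ (M : ℝ) →
      ∀ p : Fin N → UnitAddTorus (Fin d),
        c * r ^ ((d : ℝ) / 2) * (N : ℝ) ^ ((1 : ℝ) / 2 - 1 / (2 * (d : ℝ))) ≤
          Real.sqrt (1 / ((gridIndices M).card : ℝ) ^ d *
            ∑ k ∈ ({1, 2} : Finset ℕ),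
              ∑ j ∈ Fintype.piFinset (fun _ : Fin d => gridIndices M),
                |discrepancy
                  (torusTranslate (gridPoint M j) (torusBall d ((k : ℝ) * r))) p| ^ 2) := by
  obtain ⟨n, rfl⟩ := Nat.exists_eq_succ_of_ne_zero hd0.ne'
  rw [Nat.succ_eq_add_one] at *
  have hn : ¬ 4 ∣ n := fun h => hd (by
    have := (Nat.modEq_zero_iff_dvd.2 h).add_right 1
    simpa using this)
  obtain ⟨t₀, c₀, ht₀, hc₀, hcoeff⟩ := exists_le_ballCoeff_sq hn
  set V := unitBallVolume (n + 1) with hV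
  have hVpos : 0 < V := unitBallVolume_pos _
  have hpi := Real.pi_pos
  set P : ℝ := 2 * Real.pi * (n + 1 : ℕ) with hP
  have hPpos : 0 < P := by positivity
  -- `K₀` is twice the constant in `2 t₀ / r + 1 ≤ K₀ / (2 r)`, so that the frequencies below
  -- `t₀ / r` carry at most half of the mean square of the exponential sums.
  set K₀ : ℝ := 2 * (2 * t₀ + 1) with hK₀
  have hK₀pos : 0 < K₀ := by positivity
  set c₃ : ℝ := c₀ / (8 * P ^ (n + 2) * K₀) with hc₃
  have hc₃pos : 0 < c₃ := by positivity
  set K₂ : ℝ := 3 ^ (n + 1) * (V * ((n + 1) * (3 * (n + 1 : ℕ)) * 3 ^ n)) with hK₂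
  have hK₂pos : 0 < K₂ := by positivity
  set K₃ : ℝ := 2 * (4 * K₀) ^ (n + 1) * K₂ ^ 2 with hK₃
  have hK₃pos : 0 < K₃ := by positivity
  -- The first summand makes the cells small compared with `r`; the second, as `C ≤ C²`, brings the
  -- rounding errors below half of the main term.
  set C : ℝ := 4 * (n + 1 : ℕ) + 2 * K₃ / c₃ with hC
  have hC4 : 4 * ((n + 1 : ℕ) : ℝ) ≤ C := by
    have : 0 < 2 * K₃ / c₃ := by positivity
    linarith
  have hCpos : 0 < C := lt_of_lt_of_le (by positivity) hC4
  have hCsq : 2 * K₃ / c₃ ≤ C ^ 2 := by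
    have h1 : 1 ≤ C := by
      refine le_trans ?_ hC4
      push_cast; linarith [Nat.cast_nonneg (α := ℝ) n]
    have h2 : 2 * K₃ / c₃ ≤ C := by
      have : 0 ≤ 4 * ((n + 1 : ℕ) : ℝ) := by positivity
      linarith
    nlinarith
  refine ⟨C, Real.sqrt (c₃ / 2), hCpos, by positivity, ?_⟩
  intro r hr hr4 N hN M hMe hMC p
  have hN' : (1 : ℝ) ≤ N := by exact_mod_cast hN
  have hNpos : (0 : ℝ) < N := by linarith
  have hdpos : (0 : ℝ) < (n + 1 : ℕ) := by positivity
  set A : ℝ := (N : ℝ) ^ (1 / ((n + 1 : ℕ) : ℝ)) with hA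
  have hA1 : 1 ≤ A := Real.one_le_rpow hN' (by positivity)
  have hApos : 0 < A := by linarith
  have hAd : A ^ (n + 1) = N := by
    rw [hA, ← Real.rpow_natCast, ← Real.rpow_mul hNpos.le, one_div_mul_cancel hdpos.ne',
      Real.rpow_one]
  set G : ℝ := (N : ℝ) ^ (1 + 1 / (2 * ((n + 1 : ℕ) : ℝ))) with hG
  have hG1 : 1 ≤ G := Real.one_le_rpow hN' (by positivity)
  have hGpos : 0 < G := by linarith
  have hGsq : G ^ 2 = N ^ 2 * A := by
    rw [hG, hA, ← Real.rpow_natCast, ← Real.rpow_mul hNpos.le, ← Real.rpow_natCast,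
      ← Real.rpow_add hNpos]
    congr 1
    push_cast; field_simp
  have hMpos' : (0 : ℝ) < M := lt_of_lt_of_le (by positivity) hMC
  have hMpos : 0 < M := by exact_mod_cast hMpos'
  have hMinv : 1 / (M : ℝ) ≤ r / (C * G) := by
    rw [div_le_div_iff₀ hMpos' (by positivity), one_mul]
    calc C * G = r * (C * G * r⁻¹) := by field_simp
      _ ≤ r * M := by gcongr
  have hMr : ((n + 1 : ℕ) : ℝ) / M ≤ r / 4 := by
    calc ((n + 1 : ℕ) : ℝ) / M = (n + 1 : ℕ) * (1 / M) := by ring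
      _ ≤ (n + 1 : ℕ) * (r / (C * G)) := by gcongr
      _ ≤ (n + 1 : ℕ) * (r / (4 * (n + 1 : ℕ) * 1)) := by gcongr
      _ = r / 4 := by field_simp
  set X : ℕ := ⌈K₀ * A / r⌉₊ with hX
  have hXlow : K₀ * A / r ≤ X := Nat.le_ceil _
  have hXpos' : (0 : ℝ) < X := lt_of_lt_of_le (by positivity) hXlow
  have hXpos : 0 < X := by exact_mod_cast hXpos'
  have hXup : (X : ℝ) ≤ 2 * K₀ * A / r := by
    have h1 := Nat.ceil_lt_add_one (show 0 ≤ K₀ * A / r by positivity)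
    -- The cut-off is at least `1`, so rounding up at most doubles it.
    have h2 : 1 ≤ K₀ * A / r := by
      rw [le_div_iff₀ hr]
      have : 1 ≤ K₀ := by rw [hK₀]; linarith
      nlinarith
    calc (X : ℝ) ≤ K₀ * A / r + 1 := h1.le
      _ ≤ K₀ * A / r + K₀ * A / r := by gcongr
      _ = _ := by ring
  have hXR : 2 * N * (2 * (t₀ / r) + 1) ^ (n + 1) ≤ (X : ℝ) ^ (n + 1) := by
    have h1 : 2 * (t₀ / r) + 1 ≤ (2 * t₀ + 1) / r := by
      rw [le_div_iff₀ hr, add_mul, mul_assoc, div_mul_cancel₀ _ hr.ne']; linarith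
    have h2 : (2 : ℝ) ≤ 2 ^ (n + 1) := le_self_pow₀ (by norm_num) (by omega)
    calc 2 * N * (2 * (t₀ / r) + 1) ^ (n + 1)
        ≤ 2 ^ (n + 1) * A ^ (n + 1) * ((2 * t₀ + 1) / r) ^ (n + 1) := by rw [hAd]; gcongr
      _ = (K₀ * A / r) ^ (n + 1) := by rw [← mul_pow, ← mul_pow, hK₀]; congr 1; ring
      _ ≤ _ := by gcongr
  have hmain := le_grid_mean_of_cutoff ht₀ hcoeff hr hr4 hMpos hMe hMr hXpos hXR p
  refine Real.le_sqrt_of_sq_le (le_trans ?_ hmain)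
  have hlhs : (Real.sqrt (c₃ / 2) * r ^ (((n + 1 : ℕ) : ℝ) / 2) *
      (N : ℝ) ^ ((1 : ℝ) / 2 - 1 / (2 * ((n + 1 : ℕ) : ℝ)))) ^ 2 =
      c₃ / 2 * (r ^ (n + 1) * N / A) := by
    have e1 : (r ^ (((n + 1 : ℕ) : ℝ) / 2)) ^ 2 = r ^ (n + 1) := by
      rw [← Real.rpow_natCast, ← Real.rpow_mul hr.le, ← Real.rpow_natCast]
      congr 1; push_cast; ring
    have e2 : ((N : ℝ) ^ ((1 : ℝ) / 2 - 1 / (2 * ((n + 1 : ℕ) : ℝ)))) ^ 2 = N / A := by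
      rw [← Real.rpow_natCast, ← Real.rpow_mul hNpos.le, hA]
      nth_rw 2 [← Real.rpow_one (N : ℝ)]
      rw [← Real.rpow_sub hNpos]
      congr 1; push_cast; field_simp
    rw [mul_pow, mul_pow, Real.sq_sqrt (by positivity), e1, e2]
    ring
  rw [hlhs]
  have hmainterm := le_cutoff_main_term n hc₀ hPpos hK₀pos hApos hXpos' hr hNpos hXup
  have herror : 2 * ((2 * X) ^ (n + 1) * (N * (3 ^ (n + 1) * (V *
          ((n + 1) * (3 * (((n + 1 : ℕ) : ℝ) / M)) * (3 * r) ^ n)))) ^ 2) ≤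
      c₃ / 2 * (r ^ (n + 1) * N / A) := by
    have e1 : N * (3 ^ (n + 1) * (V * ((n + 1) * (3 * (((n + 1 : ℕ) : ℝ) / M)) * (3 * r) ^ n))) =
        K₂ * N * r ^ n * (1 / M) := by
      rw [hK₂, mul_pow]; ring
    rw [e1]
    exact cutoff_error_term_le n hc₃pos hK₀pos hK₂pos hApos hXpos' hr hNpos hCpos
      (by positivity) hXup hAd hGsq hMinv hCsq
  linarith

end
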